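/- Let $\Sigma$ be a closed connected oriented smooth surface, and let $H_\alpha, H_\beta$ be two handlebodies with boundary $\Sigma$, i.e. a Heegaard splitting $M = H_\alpha\cup_\Sigma(-H_\beta)$ of a closed connected oriented $3$-manifold. Put $L_\varepsilon=\ker\bigl(H_1(\Sigma;\mathbb Z)\to H_1(H_\varepsilon;\mathbb Z)\bigr)$ for $\varepsilon\in\{\alpha,\beta\}$. Let $D\subset\Sigma$ be a smoothly embedded closed disk, $S=\Sigma\setminus\mathrm{int}(D)$, $*\in\partial S$, $\pi=\pi_1(S,*)$, and let $\nu$ be $\partial S$ with the orientation induced from $S$. Let $\eta:\mathbb Z[\pi]\times\mathbb Z[\pi]\to\mathbb Z[\pi]$ be Turaev's homotopy intersection form, i.e. the $\mathbb Z$-bilinear map such that for all $x,y\in\pi$ $$\eta(x,y)=\sum_{p\in\xi\cap\zeta}\varepsilon_p(\xi,\zeta)\;\overline{\nu}_{*\bullet}\,\xi_{\bullet p}\,\zeta_{p\blacktriangle}\,\overline{\nu}_{\blacktriangle *},$$ where $\bullet$ and $\blacktriangle$ are points of $\nu$ just before and just after $*$, $\xi$ is a loop in $S$ based at $\bullet$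 and $\zeta$ a loop in $S$ based at $\blacktriangle$ transverse to $\xi$, which represent $x$ and $y$ when joined to $*$ along the short arcs of $\nu$; $\xi_{\bullet p}$ and $\zeta_{p\blacktriangle}$ are the parts of $\xi$ from $\bullet$ to $p$ and of $\zeta$ from $p$ to $\blacktriangle$, and $\varepsilon_p(\xi,\zeta)=\pm1$ is the sign of the basis formed by the velocities of $\xi$ and $\zeta$ at $p$. For $u,v\in\mathbb Z[\pi]$ let $\overline\eta(u,v)\in H_1(\Sigma)/(L_\alpha+L_\beta)$ be the image of $\eta(u,v)$ under the additive map $\mathbb Z[\pi]\to H_1(\Sigma)\to H_1(\Sigma)/(L_\alpha+L_\beta)$ sending each $x\in\pi$ to its homology class; on the augmentation ideal $I$ this is the map $I\to I/I^2\cong H_1(\Sigma)\to H_1(\Sigma)/(L_\alpha+L_\beta)$. A multicurve $c=c_1\sqcup\dots\sqcup c_n$ on $S$ is a finite family of disjoint oriented simple closed curves. After choosing for each $i$ a path in $S$ from $*$ to $c_i$, we regard $c$ as the element $\tilde c=\sum_i\tilde c_i$ of $\mathbb Z[\pi]$, where $\tilde c_i\in\pi$ is the class of $c_i$ joined to $*$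 along its path. If $\psi$ is a homeomorphism of $S$ fixing $\partial S$ pointwise, $\psi(c)$ is joined to $*$ along the images under $\psi$ of these paths. Then, for all multicurves $a,b$ on $S$ with $[a],[b]\in L_\alpha\cap L_\beta$, for every choice of connecting paths for $a$ and $b$, and for every homeomorphism $\psi$ of $S$ that fixes $\partial S$ pointwise and represents an element of the Johnson kernel $\mathcal K(S)$ (that is, induces the identity on $\pi/\Gamma_3\pi$, where $\Gamma_1\pi=\pi$ and $\Gamma_{k+1}\pi=[\Gamma_k\pi,\pi]$), $$\overline\eta(\tilde a,\tilde b)=\overline\eta\bigl(\widetilde{\psi(a)},\tilde b\bigr)=\overline\eta\bigl(\tilde a,\widetilde{\psi(b)}\bigr).$$ -/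

import Mathlib

open scoped Manifold ContDiff unitInterval

noncomputable section

/-! ### Loops and first homology -/

/-- The class of a loop in the fundamental group. -/
def loopClass {X : Type*} [TopologicalSpace X] {x : X} (γ : Path x x) : FundamentalGroup X x :=
  FundamentalGroup.fromPath (Path.Homotopic.Quotient.mk γ)

/-- First integral homology of a path-connected space, as the abelianized fundamental group
(written additively). -/
abbrev FirstHomology (X : Type*) [TopologicalSpace X] (x : X) : Type _ :=
  Additive (Abelianization (FundamentalGroup X x))

/-- The homology class of an element of the fundamental group. -/
def FirstHomology.of {X : Type*} [TopologicalSpace X] {x : X} (γ : FundamentalGroup X x) :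
    FirstHomology X x :=
  Additive.ofMul (Abelianization.of γ)

/-- The map induced on first homology by a continuous map. -/
def FirstHomology.map {X Y : Type*} [TopologicalSpace X] [TopologicalSpace Y] (f : C(X, Y))
    (x : X) : FirstHomology X x →+ FirstHomology Y (f x) :=
  MonoidHom.toAdditive (Abelianization.map (FundamentalGroup.map f x))

/-! ### Multicurves -/

/-- An oriented multicurve: a finite family of pairwise disjoint simple closed curves, each
parametrized (hence oriented) by the circle. -/
structure Multicurve (X : Type*) [TopologicalSpace X] where
  card : ℕ
  curve : Fin card → C(Circle, X)
  injective : ∀ i, Function.Injective (curve i)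
  disjoint : Pairwise fun i j => Disjoint (Set.range (curve i)) (Set.range (curve j))

namespace Multicurve

variable {X : Type*} [TopologicalSpace X]

/-- The image of a multicurve under a homeomorphism. -/
def image (ψ : X ≃ₜ X) (a : Multicurve X) : Multicurve X where
  card := a.card
  curve i := (ψ : C(X, X)).comp (a.curve i)
  injective i := ψ.injective.comp (a.injective i)
  disjoint i j hij := by
    have h := (Set.disjoint_image_iff ψ.injective).2 (a.disjoint hij)
    simpa [Set.range_comp] using h

/-- The `i`-th component as a loop based at its point of parameter `1`. -/
def loop (a : Multicurve X) (i : Fin a.card) : Path (a.curve i 1) (a.curve i 1) where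
  toFun t := a.curve i (Circle.exp (2 * Real.pi * t))
  continuous_toFun := by fun_prop
  source' := by simp
  target' := by simp

/-- A choice, for every component, of a path joining the base point to that component. -/
abbrev Tails (a : Multicurve X) (x : X) : Type _ := ∀ i, Path x (a.curve i 1)

/-- The images of the connecting paths under a homeomorphism fixing the base point: they join the
base point to the components of the image multicurve. -/
def Tails.image {a : Multicurve X} {x : X} (p : a.Tails x) (ψ : X ≃ₜ X) (h : ψ x = x) :
    (a.image ψ).Tails x :=
  fun i => ((p i).map ψ.continuous).cast h.symm rfl

/-- The element of the group ring defined by a multicurve whose components are joined to the base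
point: the sum over the components of the based loops so obtained. -/
def toGroupRing (a : Multicurve X) {x : X} (p : a.Tails x) :
    MonoidAlgebra ℤ (FundamentalGroup X x) :=
  ∑ i, MonoidAlgebra.single (loopClass (((p i).trans (a.loop i)).trans (p i).symm)) 1

end Multicurve

/-! ### Oriented surfaces -/

/-- A smooth surface without boundary, with an orientation given by the atlas: `ℂ` is the oriented
real plane, and all changes of charts of the atlas are smooth with positive Jacobian. -/
class OrientedSurface (M : Type*) [TopologicalSpace M] [ChartedSpace ℂ M] : Prop extends
    IsManifold 𝓘(ℝ, ℂ) ∞ M where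
  det_pos : ∀ e ∈ atlas ℂ M, ∀ e' ∈ atlas ℂ M, ∀ z ∈ (e.symm.trans e').source,
    0 < (fderiv ℝ (e.symm.trans e') z).det

/-- A smoothly embedded closed disk `D` in an oriented surface: the preimage of the closed unit
disk under a smooth, orientation-preserving chart whose range contains that disk. -/
structure EmbeddedDisk (M : Type*) [TopologicalSpace M] [ChartedSpace ℂ M]
    [OrientedSurface M] where
  chart : OpenPartialHomeomorph M ℂ
  smooth : chart ∈ IsManifold.maximalAtlas 𝓘(ℝ, ℂ) ∞ M
  oriented : ∀ e ∈ atlas ℂ M, ∀ z ∈ (chart.symm.trans e).source,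
    0 < (fderiv ℝ (chart.symm.trans e) z).det
  closedBall_subset : Metric.closedBall (0 : ℂ) 1 ⊆ chart.target

namespace EmbeddedDisk

variable {M : Type*} [TopologicalSpace M] [ChartedSpace ℂ M] [OrientedSurface M]

/-- The interior of the disk. -/
def interior (D : EmbeddedDisk M) : Set M := D.chart.symm '' Metric.ball (0 : ℂ) 1

/-- The compact surface with one boundary component `S = Σ ∖ int(D)`. -/
abbrev Compl (D : EmbeddedDisk M) : Type _ := {x : M // x ∉ D.interior}

/-- The inclusion of `S` in the closed surface. -/
def incl (D : EmbeddedDisk M) : C(D.Compl, M) := ⟨Subtype.val, continuous_subtype_val⟩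

lemma exp_mem_target (D : EmbeddedDisk M) (θ : ℝ) : ((Circle.exp θ : Circle) : ℂ) ∈
    D.chart.target :=
  D.closedBall_subset (by simp)

/-- The point of the boundary circle at angle `θ`. -/
def boundaryPoint (D : EmbeddedDisk M) (θ : ℝ) : D.Compl :=
  ⟨D.chart.symm (Circle.exp θ : Circle), by
    rintro ⟨z, hz, hzθ⟩
    have h := D.chart.symm.injOn (D.closedBall_subset (Metric.ball_subset_closedBall hz))
      (D.exp_mem_target θ) hzθ
    simp [h] at hz⟩

/-- The path along the boundary circle from angle `θ₀` to angle `θ₁`. -/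
def boundaryArc (D : EmbeddedDisk M) (θ₀ θ₁ : ℝ) :
    Path (D.boundaryPoint θ₀) (D.boundaryPoint θ₁) where
  toFun t := D.boundaryPoint (θ₀ + t * (θ₁ - θ₀))
  continuous_toFun := by
    refine Continuous.subtype_mk ?_ _
    refine D.chart.symm.continuousOn.comp_continuous (by fun_prop) fun t => ?_
    exact D.exp_mem_target _
  source' := by simp
  target' := by simp

/-- The base point `*` on the boundary of `S`. -/
def base (D : EmbeddedDisk M) : D.Compl := D.boundaryPoint 0

/-- The auxiliary point just before `*`: the boundary of `S`, oriented as the boundary of `S`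
(with `S` on its left), runs around `D` in the direction of decreasing angles. -/
def before (D : EmbeddedDisk M) : D.Compl := D.boundaryPoint (Real.pi / 2)

/-- The auxiliary point just after `*`. -/
def after (D : EmbeddedDisk M) : D.Compl := D.boundaryPoint (-(Real.pi / 2))

/-- The short boundary arc from `*` backwards to the point before it. -/
def arcToBefore (D : EmbeddedDisk M) : Path D.base D.before := D.boundaryArc 0 (Real.pi / 2)

/-- The short boundary arc from `*` forwards to the point after it. -/
def arcToAfter (D : EmbeddedDisk M) : Path D.base D.after := D.boundaryArc 0 (-(Real.pi / 2))

/-- The fundamental group `π = π₁(S, *)`. -/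
abbrev Pi (D : EmbeddedDisk M) : Type _ := FundamentalGroup D.Compl D.base

/-! ### The homotopy intersection form -/

/-- The element of `π` represented by a loop based at the point before `*`. -/
def classBefore (D : EmbeddedDisk M) (α : Path D.before D.before) : D.Pi :=
  loopClass ((D.arcToBefore.trans α).trans D.arcToBefore.symm)

/-- The element of `π` represented by a loop based at the point after `*`. -/
def classAfter (D : EmbeddedDisk M) (β : Path D.after D.after) : D.Pi :=
  loopClass ((D.arcToAfter.trans β).trans D.arcToAfter.symm)

/-- A path of `S` near the parameter `s`, read in the preferred chart at its point of
parameter `s`. -/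
def inChart (D : EmbeddedDisk M) {x y : D.Compl} (γ : Path x y) (s : I) (r : ℝ) : ℂ :=
  chartAt ℂ (γ s : M) (γ.extend r : M)

/-- The determinant, in the preferred chart, of the velocities of two paths at parameters
`s` and `t` (with `α s = β t`). -/
def crossingDet (D : EmbeddedDisk M) {x y x' y' : D.Compl} (α : Path x y) (β : Path x' y')
    (s t : I) : ℝ :=
  (deriv (D.inChart α s) s).re * (deriv (D.inChart β t) t).im -
    (deriv (D.inChart α s) s).im * (deriv (D.inChart β t) t).re

/-- The intersections of two paths, as pairs of parameters: a point through which a path passes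
several times is counted once for each passage. -/
def crossings (D : EmbeddedDisk M) {x y x' y' : D.Compl} (α : Path x y) (β : Path x' y') :
    Set (I × I) :=
  {c | α c.1 = β c.2}

/-- Two paths are transverse if they have finitely many intersections, none at an end of either
path, and if at each of them both paths have velocities, which form a basis of the tangent plane.
(Away from the intersections, paths are only required to be continuous.) -/
structure IsTransverse (D : EmbeddedDisk M) {x y x' y' : D.Compl} (α : Path x y)
    (β : Path x' y') : Prop where
  finite : (D.crossings α β).Finite
  mem_Ioo : ∀ c ∈ D.crossings α β, c.1 ∈ Set.Ioo (0 : I) 1 ∧ c.2 ∈ Set.Ioo (0 : I) 1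
  differentiableAt : ∀ c ∈ D.crossings α β,
    DifferentiableAt ℝ (D.inChart α c.1) c.1 ∧ DifferentiableAt ℝ (D.inChart β c.2) c.2
  det_ne_zero : ∀ c ∈ D.crossings α β, D.crossingDet α β c.1 c.2 ≠ 0

/-- The loop at `*` attached to an intersection: from `*` back to the point before it, along `α`
to the intersection, then along `β` to the point after `*`, and back to `*`. -/
def crossingClass (D : EmbeddedDisk M) (α : Path D.before D.before) (β : Path D.after D.after)
    (c : D.crossings α β) : D.Pi :=
  loopClass (((D.arcToBefore.trans ((α.subpath 0 c.1.1).cast α.source.symm rfl)).trans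
    ((β.subpath c.1.2 1).cast c.2 β.target.symm)).trans D.arcToAfter.symm)

/-- The signed sum, in `ℤ[π]`, of the loops attached to the intersections of `α` and `β`. -/
def crossingSum (D : EmbeddedDisk M) (α : Path D.before D.before) (β : Path D.after D.after) :
    MonoidAlgebra ℤ D.Pi :=
  ∑ᶠ c : D.crossings α β, MonoidAlgebra.single (D.crossingClass α β c)
    (SignType.sign (D.crossingDet α β c.1.1 c.1.2) : ℤ)

/-- The defining property of the homotopy intersection form: it is given by the signed sum over
intersections, for all transverse representatives. -/
def IsIntersectionForm (D : EmbeddedDisk M)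
    (η : MonoidAlgebra ℤ D.Pi →+ MonoidAlgebra ℤ D.Pi →+ MonoidAlgebra ℤ D.Pi) : Prop :=
  ∀ (α : Path D.before D.before) (β : Path D.after D.after), D.IsTransverse α β →
    η (MonoidAlgebra.single (D.classBefore α) 1) (MonoidAlgebra.single (D.classAfter β) 1) =
      D.crossingSum α β

open Classical in
/-- Turaev's homotopy intersection form `η : ℤ[π] × ℤ[π] → ℤ[π]`: the biadditive map with the
defining property. (It exists since the signed sum is a homotopy invariant, and is unique since
every pair of homotopy classes has transverse representatives.) -/
def homotopyIntersectionForm (D : EmbeddedDisk M) :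
    MonoidAlgebra ℤ D.Pi →+ MonoidAlgebra ℤ D.Pi →+ MonoidAlgebra ℤ D.Pi :=
  if h : ∃ η, D.IsIntersectionForm η then h.choose else 0

/-- The additive map `ℤ[π] → H₁(Σ)` sending `x ∈ π` to its homology class. It sends `x - 1` to the
class of `x`, so on the augmentation ideal `I` it is the map `I → I / I² ≅ H₁(Σ)`. -/
def homologyClass (D : EmbeddedDisk M) :
    MonoidAlgebra ℤ D.Pi →+ FirstHomology M (D.incl D.base) :=
  (Finsupp.liftAddHom fun x : D.Pi => zmultiplesHom _
    (FirstHomology.map D.incl D.base (FirstHomology.of x))).comp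
    MonoidAlgebra.coeffAddEquiv.toAddMonoidHom

/-! ### The Johnson kernel -/

/-- A homeomorphism of `S` fixing the boundary pointwise. -/
def FixesBoundary (D : EmbeddedDisk M) (ψ : D.Compl ≃ₜ D.Compl) : Prop :=
  ∀ θ : ℝ, ψ (D.boundaryPoint θ) = D.boundaryPoint θ

lemma FixesBoundary.map_base {D : EmbeddedDisk M} {ψ : D.Compl ≃ₜ D.Compl}
    (h : D.FixesBoundary ψ) : ψ D.base = D.base :=
  h 0

/-- `ψ` represents an element of the Johnson kernel of `S`: it fixes the boundary pointwise, and
induces the identity on `π / Γ₃ π` (the lower central series of the library starts at index `0`,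
so that `Γ₃ π` has index `2`). This only depends on the isotopy class of `ψ`. -/
structure InJohnsonKernel (D : EmbeddedDisk M) (ψ : D.Compl ≃ₜ D.Compl) : Prop where
  fixesBoundary : D.FixesBoundary ψ
  induced_eq : ∀ x : D.Pi,
    (QuotientGroup.mk (FundamentalGroup.mapOfEq (ψ : C(D.Compl, D.Compl)) fixesBoundary.map_base x) :
      D.Pi ⧸ (⊤ : Subgroup D.Pi).lowerCentralSeries 2) = QuotientGroup.mk x

end EmbeddedDisk

/-! ### Handlebodies and Heegaard splittings -/

/-- A closed disk in the plane with `g` disjoint round open disks removed. -/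
def planarDomain (g : ℕ) : Set ℂ :=
  Metric.closedBall 0 (g + 1) \ ⋃ k : Fin g, Metric.ball ((k : ℕ) : ℂ) (1 / 4)

/-- The handlebody of genus `g`: the product of an interval with a disk with `g` holes. -/
def handlebody (g : ℕ) : Set (ℂ × ℝ) := planarDomain g ×ˢ Set.Icc (0 : ℝ) 1

/-- A handlebody with boundary `M`: a homeomorphism from `M` to the boundary of the handlebody of
some genus. -/
structure HandlebodyFilling (M : Type*) [TopologicalSpace M] where
  genus : ℕ
  toMap : C(M, handlebody genus)
  isEmbedding : Topology.IsEmbedding toMap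
  range_eq : Set.range (fun x => (toMap x : ℂ × ℝ)) = frontier (handlebody genus)

/-- The kernel `L` of the map induced by the inclusion of the surface in the handlebody on first
homology. -/
def HandlebodyFilling.lagrangian {M : Type*} [TopologicalSpace M] (V : HandlebodyFilling M)
    (x : M) : AddSubgroup (FirstHomology M x) :=
  (FirstHomology.map V.toMap x).ker

/-- A Heegaard splitting with Heegaard surface `M`: two handlebodies `H_α`, `H_β` with boundary
`M`. The closed 3-manifold is obtained by gluing them along `M`. -/
structure HeegaardSplitting (M : Type*) [TopologicalSpace M] where
  alpha : HandlebodyFilling M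
  beta : HandlebodyFilling M

/-- The reduction `η̄` of the homotopy intersection form: the image of `η(u, v)` in
`H₁(Σ) / (L_α + L_β)`. -/
def HeegaardSplitting.reducedForm {M : Type*} [TopologicalSpace M] [ChartedSpace ℂ M]
    [OrientedSurface M] (H : HeegaardSplitting M) (D : EmbeddedDisk M)
    (u v : MonoidAlgebra ℤ D.Pi) :
    FirstHomology M (D.incl D.base) ⧸
      (H.alpha.lagrangian (D.incl D.base) ⊔ H.beta.lagrangian (D.incl D.base)) :=
  QuotientAddGroup.mk (D.homologyClass (D.homotopyIntersectionForm u v))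

end

open scoped Manifold ContDiff unitInterval

noncomputable section

/-! ### Functions with bi-additive deviation from additivity -/

/-! Fix z in π and let f(x) be the class of η(x, z) in H₁(Σ). The form is a Fox derivative: η(xy, z)
= η(y, z) + η(x, z)y, in the multiplication of `FundamentalGroup`. Right multiplication of u by y
adds ε(u)[y] to its homology class, with ε the augmentation. Hence f(xy) − f(x) − f(y) = ε(η(x,
z))[y], which is additive in x and in y. A function with such a deviation does not change when its
argument is multiplied by an element of Γ₃π (`apply_mul_eq_of_mem_lowerCentralSeries_two`), and the
second variable behaves in the same way. An element of the Johnson kernel changes each based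
component of a multicurve by a factor in Γ₃π, so expanding over pairs of components gives the
equalities already in H₁(Σ).

Most of the work is the Fox rule, because η is known only on transverse representatives. Splitting
the crossings of a concatenation is elementary (`crossingSum_trans_left`,
`crossingSum_trans_right`), but it requires two loops of given classes transverse to one and the
same third loop. They come from `exists_isTransverse_homotopic`: a path is cut into pieces lying in
cells that are convex in a chart, and is replaced by a broken line with generic vertices. The bad
positions of a vertex are critical values of ruled surfaces, a null set by Sard. Existence of η,
that is homotopy invariance of the signed sum, is not needed: without it `homotopyIntersectionForm`
is zero. -/

open scoped commutatorElement in
/-- A function on a group whose deviation from additivity is bi-additive is invariant under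
left multiplication by the third term of the lower central series. -/
theorem apply_mul_eq_of_mem_lowerCentralSeries_two {G A : Type*} [Group G] [AddCommGroup A]
    (f : G → A) (B : G → G → A) (hf : ∀ x y, f (x * y) = f x + f y + B x y)
    (hl : ∀ x y z, B (x * y) z = B x z + B y z) (hr : ∀ x y z, B x (y * z) = B x y + B x z)
    {k : G} (hk : k ∈ (⊤ : Subgroup G).lowerCentralSeries 2) (x : G) : f (k * x) = f x := by
  let Bl : G → G →* Multiplicative A := fun z => MonoidHom.mk' (fun x => .ofAdd (B x z))
    fun x y => by rw [hl]; rfl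
  let Br : G → G →* Multiplicative A := fun z => MonoidHom.mk' (fun x => .ofAdd (B z x))
    fun x y => by rw [hr]; rfl
  -- In each slot `B` is a homomorphism to an abelian group, so it kills commutators.
  have hBl : ∀ z, ∀ c ∈ commutator G, B c z = 0 := fun z c hc =>
    (Abelianization.commutator_subset_ker (Bl z) hc : _)
  have hBr : ∀ z, ∀ c ∈ commutator G, B z c = 0 := fun z c hc =>
    (Abelianization.commutator_subset_ker (Br z) hc : _)
  -- On the commutator subgroup `f` is additive; `N` is its kernel there.
  let N : Subgroup G :=
    { carrier := {c | c ∈ commutator G ∧ f c = 0}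
      one_mem' := ⟨one_mem _, by
        have h := hf 1 1
        rw [hBl 1 1 (one_mem _)] at h
        simpa using h⟩
      mul_mem' := by
        rintro c d ⟨hc, hc'⟩ ⟨hd, hd'⟩
        exact ⟨mul_mem hc hd, by rw [hf, hc', hd', hBl d c hc]; simp⟩
      inv_mem' := by
        rintro c ⟨hc, hc'⟩
        refine ⟨inv_mem hc, ?_⟩
        have h := hf c c⁻¹
        have h1 := hf 1 1
        rw [hBl 1 1 (one_mem _)] at h1
        rw [hc', hBl _ c hc, mul_inv_cancel] at h
        simp only [mul_one, add_zero, zero_add] at h h1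
        rw [← h]
        simpa using h1 }
  have hN : (⊤ : Subgroup G).lowerCentralSeries 2 ≤ N := by
    have h1 : (⊤ : Subgroup G).lowerCentralSeries 1 = commutator G := by
      simp [commutator_def]
    rw [Subgroup.lowerCentralSeries_succ, h1, Subgroup.commutator_le]
    intro c hc y _
    have hcy : ⁅c, y⁆ ∈ commutator G := Subgroup.commutator_mem_commutator
      (Subgroup.mem_top _) (Subgroup.mem_top _)
    refine ⟨hcy, ?_⟩
    -- Since `B` vanishes on `c` in both slots, `f (c * y) = f (y * c)`; this identity then forces
    -- `f ⁅c, y⁆ = 0`.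
    have h : ⁅c, y⁆ * (y * c) = c * y := by simp [commutatorElement_def, mul_assoc]
    have h2 := hf ⁅c, y⁆ (y * c)
    rw [h, hf c y, hf y c, hBl _ _ hc, hBr _ _ hc, hBl _ _ hcy] at h2
    simp only [add_zero] at h2
    rw [add_comm (f y)] at h2
    exact right_eq_add.1 h2
  obtain ⟨hc, h0⟩ := hN hk
  rw [hf, h0, hBl _ _ hc]
  simp

/-! ### Plane calculus -/

namespace PlaneCalculus

open Filter Topology MeasureTheory

/-- The determinant of two vectors of the oriented real plane `ℂ`. -/
def det (u v : ℂ) : ℝ := u.re * v.im - u.im * v.re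

lemma det_swap (u v : ℂ) : det v u = -det u v := by simp only [det]; ring

lemma det_smul_left (c : ℝ) (u v : ℂ) : det (c • u) v = c * det u v := by
  simp only [det, Complex.smul_re, Complex.smul_im, smul_eq_mul]; ring

lemma det_smul_right (c : ℝ) (u v : ℂ) : det u (c • v) = c * det u v := by
  simp only [det, Complex.smul_re, Complex.smul_im, smul_eq_mul]; ring

lemma det_map (L : ℂ →L[ℝ] ℂ) (u v : ℂ) : det (L u) (L v) = det (L 1) (L Complex.I) * det u v := by
  have h : ∀ w : ℂ, L w = w.re • L 1 + w.im • L Complex.I := fun w => by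
    rw [← L.map_smul, ← L.map_smul, ← L.map_add]
    congr 1
    simp
  rw [h u, h v]
  simp only [det, Complex.add_re, Complex.add_im, Complex.smul_re, Complex.smul_im, smul_eq_mul]
  ring

/-- By `det_map` for `L'`, this determinant divides det(1, i) = 1. -/
lemma det_map_ne_zero {L L' : ℂ →L[ℝ] ℂ} (h : L'.comp L = .id ℝ ℂ) :
    det (L 1) (L Complex.I) ≠ 0 := by
  intro h0
  have h1 := det_map L' (L 1) (L Complex.I)
  rw [h0, mul_zero] at h1
  have h2 : ∀ w, L' (L w) = w := fun w => DFunLike.congr_fun h w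
  rw [h2, h2] at h1
  simp [det] at h1

/-- The linear map of the plane with the given columns. -/
def ofColumns (u v : ℂ) : ℂ →L[ℝ] ℂ := Complex.reCLM.smulRight u + Complex.imCLM.smulRight v

lemma det_ofColumns (u v : ℂ) : (ofColumns u v).det = det u v := by
  rw [ContinuousLinearMap.det, ← LinearMap.det_toMatrix Complex.basisOneI, Matrix.det_fin_two]
  simp [LinearMap.toMatrix_apply, ofColumns, det]
  ring

/-- Sard's lemma for a ruled surface. -/
lemma volume_critical_ruled_eq_zero {T : Set ℝ} {u v u' v' : ℝ → ℂ}
    (hu : ∀ t ∈ T, HasDerivAt u (u' t) t) (hv : ∀ t ∈ T, HasDerivAt v (v' t) t) :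
    volume {q : ℂ | ∃ t ∈ T, ∃ s : ℝ, q = u t + s • v t ∧ det (v t) (u' t + s • v' t) = 0} = 0 := by
  -- The plane serves as parameter space, with s = Re w and t = Im w; the columns of the
  -- differential of `F` are its s- and t-derivatives.
  let S : Set ℂ := {w | w.im ∈ T ∧ det (v w.im) (u' w.im + w.re • v' w.im) = 0}
  let F : ℂ → ℂ := fun w => u w.im + w.re • v w.im
  have hF : ∀ w ∈ S, HasFDerivWithinAt F (ofColumns (v w.im) (u' w.im + w.re • v' w.im)) S w := by
    rintro w ⟨hw, -⟩
    have h1 : HasFDerivAt (fun w : ℂ => u w.im) (Complex.imCLM.smulRight (u' w.im)) w := by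
      exact ((hu _ hw).hasFDerivAt.comp w Complex.imCLM.hasFDerivAt).congr_fderiv
        (by ext; simp)
    have h2 : HasFDerivAt (fun w : ℂ => v w.im) (Complex.imCLM.smulRight (v' w.im)) w := by
      exact ((hv _ hw).hasFDerivAt.comp w Complex.imCLM.hasFDerivAt).congr_fderiv
        (by ext; simp)
    have h3 := h1.add (Complex.reCLM.hasFDerivAt.smul h2)
    exact (h3.congr_fderiv (by ext; simp [ofColumns]; ring)).hasFDerivWithinAt
  have := addHaar_image_eq_zero_of_det_fderivWithin_eq_zero volume hF
    fun w hw => by rw [det_ofColumns]; exact hw.2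
  refine measure_mono_null ?_ this
  rintro q ⟨t, ht, s, rfl, h⟩
  exact ⟨⟨s, t⟩, ⟨ht, h⟩, rfl⟩

/-- Crossings of plane curves with independent velocities are isolated. -/
lemma eventually_ne_of_det_ne_zero {f g : ℝ → ℂ} {f' g' : ℂ} {s t : ℝ} (hf : HasDerivAt f f' s)
    (hg : HasDerivAt g g' t) (h : det f' g' ≠ 0) :
    ∀ᶠ w : ℝ × ℝ in 𝓝[≠] (s, t), f w.1 ≠ g w.2 := by
  have h1 := (hf.hasFDerivAt.comp (s, t) (hasFDerivAt_fst (𝕜 := ℝ) (p := (s, t)))).sub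
    (hg.hasFDerivAt.comp (s, t) (hasFDerivAt_snd (𝕜 := ℝ) (p := (s, t))))
  refine (h1.eventually_ne (c := 0) ?_).mono fun w hw => by simpa [sub_eq_zero] using hw
  -- The differential of (r, r') ↦ f(r) − g(r') is injective, hence bounded below, so this map takes
  -- no value twice near the point, counting the point itself.
  obtain ⟨K, -, hK⟩ := LinearMap.exists_antilipschitzWith
    (((ContinuousLinearMap.toSpanSingleton ℝ f').comp (ContinuousLinearMap.fst ℝ ℝ ℝ) -
    (ContinuousLinearMap.toSpanSingleton ℝ g').comp (ContinuousLinearMap.snd ℝ ℝ ℝ) :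
      ℝ × ℝ →L[ℝ] ℂ) : ℝ × ℝ →ₗ[ℝ] ℂ) (by
    rw [LinearMap.ker_eq_bot']
    rintro ⟨x, y⟩ hxy
    have hxy' : x • f' = y • g' := by simpa [sub_eq_zero] using hxy
    have hx : x * det f' g' = 0 := by
      rw [← det_smul_left, hxy', det_smul_left]; simp only [det]; ring
    have hy : y * det f' g' = 0 := by
      rw [← det_smul_right, ← hxy', det_smul_right]; simp only [det]; ring
    simp [(mul_eq_zero.1 hx).resolve_right h, (mul_eq_zero.1 hy).resolve_right h])
  exact ⟨K, hK⟩

end PlaneCalculus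

/-! ### The two halves of a concatenation -/

namespace unitInterval

/-- The map of the unit interval onto its first half. -/
def firstHalf (s : I) : I := ⟨s / 2, by constructor <;> linarith [s.2.1, s.2.2]⟩

/-- The map of the unit interval onto its second half. -/
def secondHalf (s : I) : I := ⟨(1 + s) / 2, by constructor <;> linarith [s.2.1, s.2.2]⟩

lemma coe_firstHalf (s : I) : (firstHalf s : ℝ) = s / 2 := rfl

lemma coe_secondHalf (s : I) : (secondHalf s : ℝ) = (1 + s) / 2 := rfl

lemma firstHalf_injective : Function.Injective firstHalf := fun s t h => by
  have h1 := congrArg Subtype.val h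
  rw [coe_firstHalf, coe_firstHalf] at h1
  exact Subtype.ext (by linarith)

lemma secondHalf_injective : Function.Injective secondHalf := fun s t h => by
  have h1 := congrArg Subtype.val h
  rw [coe_secondHalf, coe_secondHalf] at h1
  exact Subtype.ext (by linarith)

lemma exists_half (u : I) : (∃ s, u = firstHalf s) ∨ ∃ s, u = secondHalf s := by
  rcases le_total (u : ℝ) (1 / 2) with h | h
  · exact .inl ⟨⟨2 * u, by constructor <;> linarith [u.2.1]⟩, Subtype.ext (by
      rw [coe_firstHalf]; ring)⟩
  · exact .inr ⟨⟨2 * u - 1, by constructor <;> linarith [u.2.2]⟩, Subtype.ext (by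
      rw [coe_secondHalf]; ring)⟩

lemma firstHalf_mem_Ioo {s : I} (h : s ∈ Set.Ioo (0 : I) 1) : firstHalf s ∈ Set.Ioo (0 : I) 1 := by
  have h1 : (0 : ℝ) < s := h.1
  have h2 : (s : ℝ) < 1 := h.2
  refine ⟨Subtype.coe_lt_coe.1 ?_, Subtype.coe_lt_coe.1 ?_⟩ <;> rw [coe_firstHalf]
  · exact half_pos h1
  · rw [Set.Icc.coe_one]; linarith

lemma secondHalf_mem_Ioo {s : I} (h : s ∈ Set.Ioo (0 : I) 1) :
    secondHalf s ∈ Set.Ioo (0 : I) 1 := by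
  have h1 : (0 : ℝ) < s := h.1
  have h2 : (s : ℝ) < 1 := h.2
  refine ⟨Subtype.coe_lt_coe.1 ?_, Subtype.coe_lt_coe.1 ?_⟩ <;> rw [coe_secondHalf]
  · rw [Set.Icc.coe_zero]; linarith
  · rw [Set.Icc.coe_one]; linarith

/-- The two halves share only the midpoint, which is the image of 1 under `firstHalf`. -/
lemma firstHalf_ne_secondHalf {s t : I} (h : s ≠ 1) : firstHalf s ≠ secondHalf t := fun h' => by
  have h1 := congrArg Subtype.val h'
  rw [coe_firstHalf, coe_secondHalf] at h1
  exact h (Subtype.ext (le_antisymm s.2.2 (by simp; linarith [t.2.1])))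

end unitInterval

namespace Path

open unitInterval

variable {X : Type*} [TopologicalSpace X] {x y z : X} (γ : Path x y) (γ' : Path y z)

lemma trans_firstHalf (s : I) : (γ.trans γ') (firstHalf s) = γ s := by
  rw [← extend_extends', extend_trans_of_le_half _ _ (by rw [coe_firstHalf]; linarith [s.2.2]),
    coe_firstHalf, mul_div_cancel₀ _ two_ne_zero, extend_extends']

lemma trans_secondHalf (s : I) : (γ.trans γ') (secondHalf s) = γ' s := by
  rw [← extend_extends', extend_trans_of_half_le _ _ (by rw [coe_secondHalf]; linarith [s.2.1]),
    coe_secondHalf, mul_div_cancel₀ _ two_ne_zero, add_sub_cancel_left, extend_extends']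

end Path

namespace EmbeddedDisk

open Filter Topology unitInterval PlaneCalculus

variable {M : Type*} [TopologicalSpace M] [ChartedSpace ℂ M] [OrientedSurface M]
  {D : EmbeddedDisk M} {x y z x' y' z' : D.Compl}

/-! ### Velocities -/

/-- The change of coordinates between a differentiable chart and the preferred chart at a point. -/
lemma exists_hasFDerivAt_transition {e : OpenPartialHomeomorph M ℂ}
    (he : e.MDifferentiable 𝓘(ℝ, ℂ) 𝓘(ℝ, ℂ)) {p : M} (hp : p ∈ e.source) :
    ∃ L L' : ℂ →L[ℝ] ℂ, L'.comp L = .id ℝ ℂ ∧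
      HasFDerivAt (fun w => chartAt ℂ p (e.symm w)) L (e p) ∧
      HasFDerivAt (fun w => e ((chartAt ℂ p).symm w)) L' (chartAt ℂ p p) := by
  have hc : (chartAt ℂ p).MDifferentiable 𝓘(ℝ, ℂ) 𝓘(ℝ, ℂ) := mdifferentiable_chart p
  have hp' : p ∈ (chartAt ℂ p).source := mem_chart_source ℂ p
  have h1 : DifferentiableAt ℝ (fun w => chartAt ℂ p (e.symm w)) (e p) := by
    rw [← mdifferentiableAt_iff_differentiableAt]
    refine MDifferentiableAt.comp (I' := 𝓘(ℝ, ℂ)) (e p) ?_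
      (he.mdifferentiableAt_symm (e.map_source hp))
    rw [e.left_inv hp]
    exact hc.mdifferentiableAt hp'
  have h2 : DifferentiableAt ℝ (fun w => e ((chartAt ℂ p).symm w)) (chartAt ℂ p p) := by
    rw [← mdifferentiableAt_iff_differentiableAt]
    refine MDifferentiableAt.comp (I' := 𝓘(ℝ, ℂ)) (chartAt ℂ p p) ?_
      (hc.mdifferentiableAt_symm ((chartAt ℂ p).map_source hp'))
    rw [(chartAt ℂ p).left_inv hp']
    exact he.mdifferentiableAt hp
  refine ⟨_, _, ?_, h1.hasFDerivAt, h2.hasFDerivAt⟩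
  have h3 : HasFDerivAt (fun w => e ((chartAt ℂ p).symm w))
      (fderiv ℝ (fun w => e ((chartAt ℂ p).symm w)) (chartAt ℂ p p))
      (chartAt ℂ p (e.symm (e p))) := by
    rw [e.left_inv hp]
    exact h2.hasFDerivAt
  -- The two coordinate changes compose to the identity near `e p`, and derivatives are unique.
  refine (h3.comp (e p) h1.hasFDerivAt).unique ((hasFDerivAt_id _).congr_of_eventuallyEq ?_)
  have h4 : ∀ᶠ w in 𝓝 (e p), e.symm w ∈ (chartAt ℂ p).source :=
    (e.continuousAt_symm (e.map_source hp)).eventually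
      (by rw [e.left_inv hp]; exact (chartAt ℂ p).open_source.mem_nhds hp')
  filter_upwards [h4, e.open_target.mem_nhds (e.map_source hp)] with w hw hw'
  simp [(chartAt ℂ p).left_inv hw, e.right_inv hw']

/-- Chain rule. The point `p` is kept apart from `γ s` so that two paths meeting at `p` can share
the same `L`. -/
lemma hasDerivAt_inChart {e : OpenPartialHomeomorph M ℂ} {γ : Path x y} {s : I} {p : M}
    (hp : (γ s : M) = p) (hs : p ∈ e.source) {L : ℂ →L[ℝ] ℂ}
    (hL : HasFDerivAt (fun w => chartAt ℂ p (e.symm w)) L (e p))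
    {v : ℂ} (hv : HasDerivAt (fun r => e (γ.extend r : M)) v s) :
    HasDerivAt (D.inChart γ s) (L v) s := by
  subst hp
  have h0 : (γ.extend s : M) = γ s := by rw [Path.extend_extends']
  have h : HasFDerivAt (fun w => chartAt ℂ (γ s : M) (e.symm w)) L (e (γ.extend s : M)) := by
    rwa [h0]
  refine (h.comp_hasDerivAt (s : ℝ) hv).congr_of_eventuallyEq ?_
  have hc : ContinuousAt (fun r => (γ.extend r : M)) s := by fun_prop
  filter_upwards [hc.eventually (e.open_source.mem_nhds (by beta_reduce; rwa [h0]))] with r hr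
  simp [inChart, e.left_inv hr]

lemma differentiableAt_of_inChart {e : OpenPartialHomeomorph M ℂ}
    (he : e.MDifferentiable 𝓘(ℝ, ℂ) 𝓘(ℝ, ℂ)) {γ : Path x y} {s : I}
    (hs : (γ s : M) ∈ e.source) (h : DifferentiableAt ℝ (D.inChart γ s) s) :
    DifferentiableAt ℝ (fun r => e (γ.extend r : M)) s := by
  obtain ⟨-, L', -, -, hL'⟩ := exists_hasFDerivAt_transition he hs
  have h0 : (γ.extend s : M) = γ s := by rw [Path.extend_extends']
  have h1 : HasFDerivAt (fun w => e ((chartAt ℂ (γ s : M)).symm w)) L' (D.inChart γ s s) := by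
    rwa [inChart, h0]
  refine ((h1.comp_hasDerivAt (s : ℝ) h.hasDerivAt).congr_of_eventuallyEq ?_).differentiableAt
  have hc : ContinuousAt (fun r => (γ.extend r : M)) s := by fun_prop
  filter_upwards [hc.eventually ((chartAt ℂ (γ s : M)).open_source.mem_nhds
    (by beta_reduce; rw [h0]; exact mem_chart_source ℂ _))] with r hr
  simp [inChart, (chartAt ℂ (γ s : M)).left_inv hr]

lemma differentiableAt_inChart {e : OpenPartialHomeomorph M ℂ}
    (he : e.MDifferentiable 𝓘(ℝ, ℂ) 𝓘(ℝ, ℂ)) {γ : Path x y} {s : I}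
    (hs : (γ s : M) ∈ e.source) (h : DifferentiableAt ℝ (fun r => e (γ.extend r : M)) s) :
    DifferentiableAt ℝ (D.inChart γ s) s := by
  obtain ⟨L, -, -, hL, -⟩ := exists_hasFDerivAt_transition he hs
  exact (hasDerivAt_inChart rfl hs hL h.hasDerivAt).differentiableAt

/-- The independence of the velocities at an intersection may be checked in any chart. -/
lemma crossingDet_ne_zero {e : OpenPartialHomeomorph M ℂ}
    (he : e.MDifferentiable 𝓘(ℝ, ℂ) 𝓘(ℝ, ℂ)) {α : Path x y} {β : Path x' y'} {s t : I}
    (hst : α s = β t) (hs : (α s : M) ∈ e.source) {u v : ℂ}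
    (hu : HasDerivAt (fun r => e (α.extend r : M)) u s)
    (hv : HasDerivAt (fun r => e (β.extend r : M)) v t) (h : det u v ≠ 0) :
    D.crossingDet α β s t ≠ 0 := by
  obtain ⟨L, L', hLL', hL, -⟩ := exists_hasFDerivAt_transition he hs
  change det (deriv (D.inChart α s) s) (deriv (D.inChart β t) t) ≠ 0
  rw [(hasDerivAt_inChart rfl hs hL hu).deriv,
    (hasDerivAt_inChart (congrArg Subtype.val hst.symm) hs hL hv).deriv, det_map]
  exact mul_ne_zero (det_map_ne_zero hLL') h

/-! ### Transversality -/

/-- The finiteness of the set of intersections follows from the other conditions. -/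
lemma isTransverse_of_forall [T2Space M] {α : Path x y} {β : Path x' y'}
    (h1 : ∀ c ∈ D.crossings α β, c.1 ∈ Set.Ioo (0 : I) 1 ∧ c.2 ∈ Set.Ioo (0 : I) 1)
    (h2 : ∀ c ∈ D.crossings α β,
      DifferentiableAt ℝ (D.inChart α c.1) c.1 ∧ DifferentiableAt ℝ (D.inChart β c.2) c.2)
    (h3 : ∀ c ∈ D.crossings α β, D.crossingDet α β c.1 c.2 ≠ 0) : D.IsTransverse α β := by
  refine ⟨?_, h1, h2, h3⟩
  have hcl : IsClosed (D.crossings α β) :=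
    isClosed_eq (α.continuous.comp continuous_fst) (β.continuous.comp continuous_snd)
  -- The set of crossings is compact, and independent velocities make it discrete.
  refine hcl.isCompact.finite (isDiscrete_iff_nhdsNE.2 fun c hc => ?_)
  have h := eventually_ne_of_det_ne_zero (h2 c hc).1.hasDerivAt (h2 c hc).2.hasDerivAt (h3 c hc)
  have hi : Tendsto (fun c : I × I => ((c.1 : ℝ), (c.2 : ℝ))) (𝓝[≠] c)
      (𝓝[≠] ((c.1 : ℝ), (c.2 : ℝ))) := by
    refine tendsto_nhdsWithin_of_tendsto_nhds_of_eventually_within _ ?_ ?_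
    · exact Continuous.continuousAt (by fun_prop) |>.tendsto.mono_left nhdsWithin_le_nhds
    · filter_upwards [self_mem_nhdsWithin] with d hd hd'
      exact hd (Prod.ext (Subtype.ext (congrArg Prod.fst hd')) (Subtype.ext (congrArg Prod.snd hd')))
  rw [← disjoint_iff, disjoint_principal_right]
  filter_upwards [hi.eventually h] with d hd hd'
  refine hd ?_
  have h4 : α c.1 = β c.2 := hc
  have h5 : α d.1 = β d.2 := hd'
  -- Both paths are read in the same chart, because the chart is chosen at their common point.
  simp only [inChart, Path.extend_extends', h4, h5]

lemma IsTransverse.swap [T2Space M] {α : Path x y} {β : Path x' y'} (h : D.IsTransverse α β) :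
    D.IsTransverse β α := by
  refine isTransverse_of_forall (fun c hc => (h.mem_Ioo c.swap hc.symm).symm)
    (fun c hc => (h.differentiableAt c.swap hc.symm).symm) fun c hc => ?_
  have := h.det_ne_zero c.swap hc.symm
  intro h0
  refine this ?_
  change det _ _ = 0
  rw [det_swap]
  exact neg_eq_zero.2 h0

/-- Transversality excludes crossings at parameter 0. This supplies the avoidance of base points
that general position requires. -/
lemma IsTransverse.apply_ne_source {α : Path x y} {β : Path x' y'} (h : D.IsTransverse α β)
    (t : I) : β t ≠ x := fun ht =>
  (lt_irrefl _ (h.mem_Ioo (0, t) (α.source.trans ht.symm)).1.1).elim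

lemma IsTransverse.apply_ne_target {α : Path x y} {β : Path x' y'} (h : D.IsTransverse α β)
    (t : I) : β t ≠ y := fun ht =>
  (lt_irrefl _ (h.mem_Ioo (1, t) (α.target.trans ht.symm)).1.2).elim

/-! ### Concatenation -/

/-- The concatenation runs at double speed. The end `s = 1` is excluded because a corner may appear
there. -/
lemma hasDerivAt_inChart_trans_firstHalf {γ : Path x y} (γ' : Path y z) {s : I} (hs : s < 1)
    {v : ℂ} (h : HasDerivAt (D.inChart γ s) v s) :
    HasDerivAt (D.inChart (γ.trans γ') (firstHalf s)) ((2 : ℝ) • v) (firstHalf s) := by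
  have hs' : (s : ℝ) < 1 := hs
  have h1 : HasDerivAt (fun r : ℝ => 2 * r) 2 (firstHalf s) := by
    simpa using (hasDerivAt_id (_ : ℝ)).const_mul (2 : ℝ)
  have h2 : HasDerivAt (D.inChart γ s) v (2 * (firstHalf s : ℝ)) := by
    rwa [coe_firstHalf, mul_div_cancel₀ _ two_ne_zero]
  refine (h2.scomp (_ : ℝ) h1).congr_of_eventuallyEq ?_
  filter_upwards [Iio_mem_nhds (show (firstHalf s : ℝ) < 1 / 2 by rw [coe_firstHalf]; linarith)]
    with r hr
  simp [inChart, Path.trans_firstHalf, Path.extend_trans_of_le_half _ _ (le_of_lt hr)]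

lemma hasDerivAt_inChart_trans_secondHalf (γ : Path x y) {γ' : Path y z} {s : I} (hs : 0 < s)
    {v : ℂ} (h : HasDerivAt (D.inChart γ' s) v s) :
    HasDerivAt (D.inChart (γ.trans γ') (secondHalf s)) ((2 : ℝ) • v) (secondHalf s) := by
  have hs' : 0 < (s : ℝ) := hs
  have h1 : HasDerivAt (fun r : ℝ => 2 * r - 1) 2 (secondHalf s) := by
    simpa using ((hasDerivAt_id (_ : ℝ)).const_mul (2 : ℝ)).sub_const (1 : ℝ)
  have h2 : HasDerivAt (D.inChart γ' s) v (2 * (secondHalf s : ℝ) - 1) := by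
    rwa [coe_secondHalf, mul_div_cancel₀ _ two_ne_zero, add_sub_cancel_left]
  refine (HasDerivAt.scomp (h := fun r : ℝ => 2 * r - 1) (secondHalf s : ℝ) h2 h1).congr_of_eventuallyEq ?_
  filter_upwards [Ioi_mem_nhds (show 1 / 2 < (secondHalf s : ℝ) by rw [coe_secondHalf]; linarith)]
    with r hr
  simp [inChart, Path.trans_secondHalf, Path.extend_trans_of_half_le _ _ (le_of_lt hr)]

lemma crossingDet_trans_firstHalf {α : Path x y} (α' : Path y z) {β : Path x' y'} {s t : I}
    (hs : s < 1) (h : DifferentiableAt ℝ (D.inChart α s) s) :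
    D.crossingDet (α.trans α') β (firstHalf s) t = 2 * D.crossingDet α β s t := by
  change det _ _ = 2 * det _ _
  rw [(hasDerivAt_inChart_trans_firstHalf α' hs h.hasDerivAt).deriv, det_smul_left]

lemma crossingDet_trans_secondHalf (α : Path x y) {α' : Path y z} {β : Path x' y'} {s t : I}
    (hs : 0 < s) (h : DifferentiableAt ℝ (D.inChart α' s) s) :
    D.crossingDet (α.trans α') β (secondHalf s) t = 2 * D.crossingDet α' β s t := by
  change det _ _ = 2 * det _ _
  rw [(hasDerivAt_inChart_trans_secondHalf α hs h.hasDerivAt).deriv, det_smul_left]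

lemma crossingDet_trans_firstHalf_right {α : Path x y} {β : Path x' y'} (β' : Path y' z') {s t : I}
    (ht : t < 1) (h : DifferentiableAt ℝ (D.inChart β t) t) :
    D.crossingDet α (β.trans β') s (firstHalf t) = 2 * D.crossingDet α β s t := by
  change det _ _ = 2 * det _ _
  rw [(hasDerivAt_inChart_trans_firstHalf β' ht h.hasDerivAt).deriv, det_smul_right]

lemma crossingDet_trans_secondHalf_right {α : Path x y} (β : Path x' y') {β' : Path y' z'} {s t : I}
    (ht : 0 < t) (h : DifferentiableAt ℝ (D.inChart β' t) t) :
    D.crossingDet α (β.trans β') s (secondHalf t) = 2 * D.crossingDet α β' s t := by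
  change det _ _ = 2 * det _ _
  rw [(hasDerivAt_inChart_trans_secondHalf β ht h.hasDerivAt).deriv, det_smul_right]

/-- Crossings of each half are interior to it, so none sits at the corner; elsewhere the determinant
is only doubled. -/
lemma IsTransverse.trans_left [T2Space M] {α : Path x y} {α' : Path y z} {β : Path x' y'}
    (h : D.IsTransverse α β) (h' : D.IsTransverse α' β) : D.IsTransverse (α.trans α') β := by
  have key : ∀ c ∈ D.crossings (α.trans α') β,
      (∃ s, c.1 = firstHalf s ∧ (s, c.2) ∈ D.crossings α β) ∨
      ∃ s, c.1 = secondHalf s ∧ (s, c.2) ∈ D.crossings α' β := by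
    rintro ⟨u, t⟩ (hc : (α.trans α') u = β t)
    rcases exists_half u with ⟨s, rfl⟩ | ⟨s, rfl⟩
    · exact .inl ⟨s, rfl, (Path.trans_firstHalf α α' s).symm.trans hc⟩
    · exact .inr ⟨s, rfl, (Path.trans_secondHalf α α' s).symm.trans hc⟩
  refine isTransverse_of_forall ?_ ?_ ?_ <;> rintro ⟨u, t⟩ hc <;>
    rcases key _ hc with ⟨s, rfl, hs⟩ | ⟨s, rfl, hs⟩
  · exact ⟨firstHalf_mem_Ioo (h.mem_Ioo _ hs).1, (h.mem_Ioo _ hs).2⟩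
  · exact ⟨secondHalf_mem_Ioo (h'.mem_Ioo _ hs).1, (h'.mem_Ioo _ hs).2⟩
  · exact ⟨(hasDerivAt_inChart_trans_firstHalf α' (h.mem_Ioo _ hs).1.2
      (h.differentiableAt _ hs).1.hasDerivAt).differentiableAt, (h.differentiableAt _ hs).2⟩
  · exact ⟨(hasDerivAt_inChart_trans_secondHalf α (h'.mem_Ioo _ hs).1.1
      (h'.differentiableAt _ hs).1.hasDerivAt).differentiableAt, (h'.differentiableAt _ hs).2⟩
  · rw [crossingDet_trans_firstHalf α' (h.mem_Ioo _ hs).1.2 (h.differentiableAt _ hs).1]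
    exact mul_ne_zero two_ne_zero (h.det_ne_zero _ hs)
  · rw [crossingDet_trans_secondHalf α (h'.mem_Ioo _ hs).1.1 (h'.differentiableAt _ hs).1]
    exact mul_ne_zero two_ne_zero (h'.det_ne_zero _ hs)

lemma IsTransverse.trans_right [T2Space M] {α : Path x y} {β : Path x' y'} {β' : Path y' z'}
    (h : D.IsTransverse α β) (h' : D.IsTransverse α β') : D.IsTransverse α (β.trans β') :=
  (h.swap.trans_left h'.swap).swap

end EmbeddedDisk

/-! ### Convex cells -/

/-- The inversion `z ↦ z⁻¹` of the plane. -/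
def planeInversion : OpenPartialHomeomorph ℂ ℂ where
  toFun z := z⁻¹
  invFun z := z⁻¹
  source := {0}ᶜ
  target := {0}ᶜ
  map_source' z hz := by simpa using hz
  map_target' z hz := by simpa using hz
  left_inv' z _ := inv_inv z
  right_inv' z _ := inv_inv z
  open_source := isOpen_compl_singleton
  open_target := isOpen_compl_singleton
  continuousOn_toFun := continuousOn_inv₀
  continuousOn_invFun := continuousOn_inv₀

lemma mdifferentiable_planeInversion :
    planeInversion.MDifferentiable 𝓘(ℝ, ℂ) 𝓘(ℝ, ℂ) := by
  have h : DifferentiableOn ℝ (fun z : ℂ => z⁻¹) {0}ᶜ := fun z hz =>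
    ((differentiableAt_inv (𝕜 := ℂ) hz).restrictScalars ℝ).differentiableWithinAt
  exact ⟨h.mdifferentiableOn, h.mdifferentiableOn⟩

namespace EmbeddedDisk

open Filter Topology unitInterval MeasureTheory

variable {M : Type*} [TopologicalSpace M] [ChartedSpace ℂ M] [OrientedSurface M]

/-- A subset of the complement of the disk which is convex in a suitable differentiable chart. -/
structure ConvexCell (D : EmbeddedDisk M) where
  chart : OpenPartialHomeomorph M ℂ
  mdifferentiable : chart.MDifferentiable 𝓘(ℝ, ℂ) 𝓘(ℝ, ℂ)
  shape : Set ℂ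
  convex : Convex ℝ shape
  subset_target : shape ⊆ chart.target
  subset_closure : shape ⊆ closure (_root_.interior shape)
  symm_notMem : ∀ w ∈ shape, chart.symm w ∉ D.interior

variable {D : EmbeddedDisk M} {x y z x' y' z' : D.Compl}

namespace ConvexCell

variable (C : ConvexCell D)

/-- The cell, as a subset of the surface with boundary. -/
def carrier : Set D.Compl := {x | (x : M) ∈ C.chart.source ∧ C.chart x ∈ C.shape}

/-- The point with the given coordinate. -/
def ofCoord (w : C.shape) : D.Compl := ⟨C.chart.symm w, C.symm_notMem w w.2⟩

lemma continuous_ofCoord : Continuous C.ofCoord :=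
  (C.chart.symm.continuousOn.comp_continuous continuous_subtype_val
    fun w => C.subset_target w.2).subtype_mk _

lemma chart_ofCoord (w : C.shape) : C.chart (C.ofCoord w : M) = w :=
  C.chart.right_inv (C.subset_target w.2)

lemma ofCoord_mem (w : C.shape) : C.ofCoord w ∈ C.carrier :=
  ⟨C.chart.map_target (C.subset_target w.2), by rw [chart_ofCoord]; exact w.2⟩

lemma ofCoord_chart {x : D.Compl} (hx : x ∈ C.carrier) : C.ofCoord ⟨C.chart x, hx.2⟩ = x :=
  Subtype.ext (C.chart.left_inv hx.1)

lemma lineMap_mem {w w' : ℂ} (hw : w ∈ C.shape) (hw' : w' ∈ C.shape) (t : I) :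
    AffineMap.lineMap w w' (t : ℝ) ∈ C.shape :=
  C.convex.lineMap_mem hw hw' t.2

/-- The straight path between two points of a cell. -/
def segment {x y : D.Compl} (hx : x ∈ C.carrier) (hy : y ∈ C.carrier) : Path x y where
  toFun t := C.ofCoord ⟨AffineMap.lineMap (C.chart x) (C.chart y) (t : ℝ),
    C.lineMap_mem hx.2 hy.2 t⟩
  continuous_toFun := C.continuous_ofCoord.comp (Continuous.subtype_mk
    (AffineMap.lineMap_continuous.comp continuous_subtype_val) _)
  source' := by simp [C.ofCoord_chart hx]
  target' := by simp [C.ofCoord_chart hy]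

lemma chart_segment (hx : x ∈ C.carrier) (hy : y ∈ C.carrier) (t : I) :
    C.chart (C.segment hx hy t : M) = AffineMap.lineMap (C.chart x) (C.chart y) (t : ℝ) :=
  C.chart_ofCoord _

lemma segment_mem (hx : x ∈ C.carrier) (hy : y ∈ C.carrier) (t : I) :
    C.segment hx hy t ∈ C.carrier :=
  C.ofCoord_mem _

lemma hasDerivAt_segment (hx : x ∈ C.carrier) (hy : y ∈ C.carrier) {t : I}
    (ht : t ∈ Set.Ioo (0 : I) 1) :
    HasDerivAt (fun r => C.chart ((C.segment hx hy).extend r : M))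
      (C.chart y - C.chart x) t := by
  refine AffineMap.hasDerivAt_lineMap.congr_of_eventuallyEq ?_
  filter_upwards [Ioo_mem_nhds (show (0 : ℝ) < t from ht.1) (show (t : ℝ) < 1 from ht.2)] with r hr
  rw [Path.extend_apply _ ⟨hr.1.le, hr.2.le⟩, chart_segment]

/-- Paths in a cell with the same ends are homotopic. -/
lemma homotopic {γ γ' : Path x y} (h : ∀ t, γ t ∈ C.carrier) (h' : ∀ t, γ' t ∈ C.carrier) :
    γ.Homotopic γ' := by
  have hc : ∀ (γ : Path x y), (∀ t, γ t ∈ C.carrier) → Continuous fun t => C.chart (γ t : M) :=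
    fun γ h => C.chart.continuousOn.comp_continuous (by fun_prop) fun t => (h t).1
  have h1 := hc γ h
  have h2 := hc γ' h'
  refine ⟨⟨⟨⟨fun p => C.ofCoord ⟨AffineMap.lineMap (C.chart (γ p.2 : M)) (C.chart (γ' p.2 : M))
    (p.1 : ℝ), C.lineMap_mem (h p.2).2 (h' p.2).2 p.1⟩, ?_⟩, ?_, ?_⟩, ?_⟩⟩
  · refine C.continuous_ofCoord.comp (Continuous.subtype_mk ?_ _)
    simp only [AffineMap.lineMap_apply_module]
    have h3 := h1.comp (continuous_snd (X := I) (Y := I))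
    have h4 := h2.comp (continuous_snd (X := I) (Y := I))
    have h5 : Continuous fun p : I × I => (p.1 : ℝ) := by fun_prop
    exact ((continuous_const.sub h5).smul h3).add (h5.smul h4)
  · intro t
    simp [C.ofCoord_chart (h t)]
  · intro t
    simp [C.ofCoord_chart (h' t)]
  · rintro s t (rfl | rfl)
    · have hx : x ∈ C.carrier := by simpa using h 0
      simp [C.ofCoord_chart hx]
    · have hy : y ∈ C.carrier := by simpa using h 1
      simp [C.ofCoord_chart hy]

/-- Outside a null set of coordinates, every point of a cell has neighbours, joined to it by a
short segment. -/
lemma exists_segment_subset (hx : x ∈ C.carrier) {W : Set D.Compl} (hW : W ∈ 𝓝 x) {N : Set ℂ}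
    (hN : volume N = 0) :
    ∃ (y : D.Compl) (hy : y ∈ C.carrier), C.chart y ∉ N ∧ ∀ t, C.segment hx hy t ∈ W := by
  have h1 : C.ofCoord ⁻¹' W ∈ 𝓝 (⟨C.chart x, hx.2⟩ : C.shape) :=
    C.continuous_ofCoord.continuousAt.preimage_mem_nhds (by rwa [C.ofCoord_chart hx])
  obtain ⟨ε, hε, hball⟩ := Metric.mem_nhds_iff.1 h1
  have hopen : IsOpen (_root_.interior C.shape ∩ Metric.ball (C.chart x) ε) :=
    isOpen_interior.inter Metric.isOpen_ball
  have hne : (_root_.interior C.shape ∩ Metric.ball (C.chart x) ε).Nonempty := by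
    -- Density of the interior in the shape is used here: the candidate end points have positive
    -- area and cannot all lie in `N`.
    rw [Set.inter_comm]
    exact mem_closure_iff.1 (C.subset_closure hx.2) _ Metric.isOpen_ball (Metric.mem_ball_self hε)
  have hpos := hopen.measure_pos volume hne
  obtain ⟨w, ⟨hw, hwε⟩, hwN⟩ : ∃ w ∈ _root_.interior C.shape ∩ Metric.ball (C.chart x) ε,
      w ∉ N := by
    by_contra! h
    exact hpos.ne' (measure_mono_null h hN)
  refine ⟨C.ofCoord ⟨w, interior_subset hw⟩, C.ofCoord_mem _, by rwa [chart_ofCoord], fun t => ?_⟩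
  refine hball ?_
  rw [Metric.mem_ball, Subtype.dist_eq, ← Metric.mem_ball]
  refine (convex_ball _ _).lineMap_mem (Metric.mem_ball_self hε) ?_ t.2
  rwa [chart_ofCoord]

end ConvexCell

lemma mdifferentiable_chart (D : EmbeddedDisk M) :
    D.chart.MDifferentiable 𝓘(ℝ, ℂ) 𝓘(ℝ, ℂ) :=
  ⟨(contMDiffOn_of_mem_maximalAtlas D.smooth).mdifferentiableOn (by simp),
    (contMDiffOn_symm_of_mem_maximalAtlas D.smooth).mdifferentiableOn (by simp)⟩

/-- Every point of the surface has a neighbourhood which is a cell. Near the boundary, one uses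
that the inversion turns the exterior of the unit disk into a convex set. -/
lemma exists_convexCell [T2Space M] (D : EmbeddedDisk M) (x : D.Compl) :
    ∃ C : ConvexCell D, C.carrier ∈ 𝓝 x := by
  -- A point of the closed disk outside its interior is on the boundary circle; the other case is an
  -- interior point of the surface.
  by_cases hx : (x : M) ∈ D.chart.symm '' Metric.closedBall 0 1
  · obtain ⟨w, hw, hwx⟩ := hx
    have hwt : w ∈ D.chart.target := D.closedBall_subset hw
    have hcx : D.chart (x : M) = w := by rw [← hwx, D.chart.right_inv hwt]
    have hnorm : ∀ y : D.Compl, (y : M) ∈ D.chart.source → 1 ≤ ‖D.chart y‖ := by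
      intro y hy
      by_contra! h
      exact y.2 ⟨D.chart y, by simpa using h, D.chart.left_inv hy⟩
    have hxs : (x : M) ∈ D.chart.source := hwx ▸ D.chart.map_target hwt
    have hw1 : 1 ≤ ‖w‖ := hcx ▸ hnorm x hxs
    have hw0 : w ≠ 0 := norm_pos_iff.1 (by linarith)
    let e := D.chart.trans planeInversion
    have hxe : (x : M) ∈ e.source := by
      simp only [e, OpenPartialHomeomorph.trans_source]
      exact ⟨hxs, by simpa [planeInversion, hcx] using hw0⟩
    obtain ⟨r, hr, hball⟩ := Metric.isOpen_iff.1 e.open_target (e x) (e.map_source hxe)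
    refine ⟨⟨e, D.mdifferentiable_chart.trans mdifferentiable_planeInversion,
      Metric.ball (e x) r ∩ Metric.closedBall 0 1, (convex_ball _ _).inter (convex_closedBall _ _),
      fun w hw => hball hw.1, ?_, ?_⟩, ?_⟩
    · rw [interior_inter, Metric.isOpen_ball.interior_eq, interior_closedBall _ one_ne_zero,
        ← closure_ball (0 : ℂ) one_ne_zero]
      exact Metric.isOpen_ball.inter_closure
    · rintro v ⟨hv, hv1⟩ ⟨u, hu, huv⟩
      have hvt := hball hv
      simp only [e, OpenPartialHomeomorph.trans_target] at hvt
      have h1 : u = v⁻¹ := D.chart.symm.injOn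
        (D.closedBall_subset (Metric.ball_subset_closedBall hu)) hvt.2 huv
      have hv0 : v ≠ 0 := hvt.1
      rw [h1, mem_ball_zero_iff, norm_inv] at hu
      rw [mem_closedBall_zero_iff] at hv1
      exact absurd hu (not_lt.2 ((one_le_inv₀ (norm_pos_iff.2 hv0)).2 hv1))
    · have h1 : {y : D.Compl | (y : M) ∈ e.source ∩ e ⁻¹' Metric.ball (e x) r} ∈ 𝓝 x :=
        ((e.isOpen_inter_preimage Metric.isOpen_ball).preimage continuous_subtype_val).mem_nhds
          ⟨hxe, Metric.mem_ball_self hr⟩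
      filter_upwards [h1] with y hy
      refine ⟨hy.1, hy.2, ?_⟩
      have hys : (y : M) ∈ D.chart.source := by
        have := hy.1
        simp only [e, OpenPartialHomeomorph.trans_source] at this
        exact this.1
      rw [mem_closedBall_zero_iff]
      change ‖(D.chart (y : M))⁻¹‖ ≤ 1
      rw [norm_inv]
      exact inv_le_one_of_one_le₀ (hnorm y hys)
  · have hcl : IsClosed (D.chart.symm '' Metric.closedBall 0 1) :=
      ((isCompact_closedBall _ _).image_of_continuousOn
        (D.chart.symm.continuousOn.mono D.closedBall_subset)).isClosed
    let e := chartAt ℂ (x : M)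
    have hxe : (x : M) ∈ e.source := mem_chart_source ℂ _
    -- The closed disk is closed in `M`, so a small coordinate ball misses it.
    obtain ⟨r, hr, hball⟩ := Metric.isOpen_iff.1 (e.isOpen_inter_preimage_symm hcl.isOpen_compl)
      (e x) ⟨e.map_source hxe, by simpa [e.left_inv hxe] using hx⟩
    refine ⟨⟨e, _root_.mdifferentiable_chart _, Metric.ball (e x) r, convex_ball _ _,
      fun w hw => (hball hw).1, ?_, fun w hw => ?_⟩, ?_⟩
    · rw [Metric.isOpen_ball.interior_eq]
      exact subset_closure
    · exact fun h => (hball hw).2 (Set.image_mono Metric.ball_subset_closedBall h)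
    · exact ((e.isOpen_inter_preimage Metric.isOpen_ball).preimage
        continuous_subtype_val).mem_nhds ⟨hxe, Metric.mem_ball_self hr⟩

end EmbeddedDisk

/-! ### General position -/

namespace EmbeddedDisk

open Filter Topology unitInterval MeasureTheory PlaneCalculus

variable {M : Type*} [TopologicalSpace M] [ChartedSpace ℂ M] [OrientedSurface M]
  {D : EmbeddedDisk M} {x y z x' y' z' : D.Compl}

/-- A path is piecewise differentiable if it has a velocity at all but finitely many parameters.
The ends always count as exceptional. -/
def IsPiecewiseDifferentiable (D : EmbeddedDisk M) {x y : D.Compl} (γ : Path x y) : Prop :=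
  ∃ E : Set I, E.Finite ∧
    ∀ t ∉ E, t ∈ Set.Ioo (0 : I) 1 ∧ DifferentiableAt ℝ (D.inChart γ t) t

lemma isPiecewiseDifferentiable_of_forall {γ : Path x y}
    (h : ∀ t ∈ Set.Ioo (0 : I) 1, DifferentiableAt ℝ (D.inChart γ t) t) :
    D.IsPiecewiseDifferentiable γ := by
  refine ⟨{0, 1}, by simp, fun t ht => ?_⟩
  have ht' : t ∈ Set.Ioo (0 : I) 1 := by
    simp only [Set.mem_insert_iff, Set.mem_singleton_iff, not_or] at ht
    exact ⟨lt_of_le_of_ne t.2.1 (Ne.symm ht.1), lt_of_le_of_ne t.2.2 ht.2⟩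
  exact ⟨ht', h t ht'⟩

lemma isPiecewiseDifferentiable_refl (x : D.Compl) :
    D.IsPiecewiseDifferentiable (Path.refl x) :=
  isPiecewiseDifferentiable_of_forall fun t _ =>
    (differentiableAt_const (chartAt ℂ (x : M) (x : M))).congr_of_eventuallyEq
      (.of_forall fun r => by simp [inChart])

lemma ConvexCell.isPiecewiseDifferentiable_segment (C : ConvexCell D) (hx : x ∈ C.carrier)
    (hy : y ∈ C.carrier) : D.IsPiecewiseDifferentiable (C.segment hx hy) :=
  isPiecewiseDifferentiable_of_forall fun t ht =>
    differentiableAt_inChart C.mdifferentiable (C.segment_mem hx hy t).1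
      (C.hasDerivAt_segment hx hy ht).differentiableAt

lemma IsPiecewiseDifferentiable.trans {γ : Path x y} {γ' : Path y z}
    (h : D.IsPiecewiseDifferentiable γ) (h' : D.IsPiecewiseDifferentiable γ') :
    D.IsPiecewiseDifferentiable (γ.trans γ') := by
  obtain ⟨E, hE, h⟩ := h
  obtain ⟨E', hE', h'⟩ := h'
  refine ⟨firstHalf '' E ∪ secondHalf '' E', (hE.image _).union (hE'.image _), fun t ht => ?_⟩
  rcases exists_half t with ⟨s, rfl⟩ | ⟨s, rfl⟩
  · obtain ⟨h1, h2⟩ := h s fun hs => ht (.inl ⟨s, hs, rfl⟩)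
    exact ⟨firstHalf_mem_Ioo h1,
      (hasDerivAt_inChart_trans_firstHalf γ' h1.2 h2.hasDerivAt).differentiableAt⟩
  · obtain ⟨h1, h2⟩ := h' s fun hs => ht (.inr ⟨s, hs, rfl⟩)
    exact ⟨secondHalf_mem_Ioo h1,
      (hasDerivAt_inChart_trans_secondHalf γ h1.1 h2.hasDerivAt).differentiableAt⟩

lemma hasDerivAt_inChart_symm {γ : Path x y} {s : I} {v : ℂ}
    (h : HasDerivAt (D.inChart γ (σ s)) v (σ s)) : HasDerivAt (D.inChart γ.symm s) (-v) s := by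
  have h1 : HasDerivAt (fun r : ℝ => 1 - r) (-1) s := by
    simpa using (hasDerivAt_id (s : ℝ)).const_sub (1 : ℝ)
  have h2 : HasDerivAt (D.inChart γ (σ s)) v (1 - (s : ℝ)) := h
  have h3 := HasDerivAt.scomp (h := fun r : ℝ => 1 - r) (s : ℝ) h2 h1
  rw [neg_one_smul] at h3
  refine h3.congr_of_eventuallyEq (.of_forall fun r => ?_)
  simp [inChart, Path.extend_symm_apply]

lemma symm_mem_Ioo {s : I} (h : σ s ∈ Set.Ioo (0 : I) 1) : s ∈ Set.Ioo (0 : I) 1 := by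
  have h1 : (0 : ℝ) < 1 - s := h.1
  have h2 : 1 - (s : ℝ) < 1 := h.2
  exact ⟨show (0 : ℝ) < s by linarith, show (s : ℝ) < 1 by linarith⟩

lemma IsPiecewiseDifferentiable.symm {γ : Path x y} (h : D.IsPiecewiseDifferentiable γ) :
    D.IsPiecewiseDifferentiable γ.symm := by
  obtain ⟨E, hE, h⟩ := h
  refine ⟨σ '' E, hE.image _, fun t ht => ?_⟩
  obtain ⟨h1, h2⟩ := h (σ t) fun hs => ht ⟨_, hs, symm_symm t⟩
  exact ⟨symm_mem_Ioo h1, (hasDerivAt_inChart_symm h2.hasDerivAt).differentiableAt⟩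

lemma IsTransverse.symm_left [T2Space M] {α : Path x y} {β : Path x' y'}
    (h : D.IsTransverse α β) : D.IsTransverse α.symm β := by
  have key : ∀ c ∈ D.crossings α.symm β, (σ c.1, c.2) ∈ D.crossings α β := fun c hc => hc
  refine isTransverse_of_forall (fun c hc => ?_) (fun c hc => ?_) fun c hc => ?_
  · exact ⟨symm_mem_Ioo (h.mem_Ioo _ (key c hc)).1, (h.mem_Ioo _ (key c hc)).2⟩
  · have h2 := h.differentiableAt _ (key c hc)
    exact ⟨(hasDerivAt_inChart_symm h2.1.hasDerivAt).differentiableAt, h2.2⟩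
  · have h2 := h.differentiableAt _ (key c hc)
    have h3 := h.det_ne_zero _ (key c hc)
    change det _ _ ≠ 0
    rw [(hasDerivAt_inChart_symm h2.1.hasDerivAt).deriv, ← neg_one_smul ℝ, det_smul_left]
    exact mul_ne_zero (by norm_num) h3

lemma isTransverse_of_forall_ne {α : Path x y} {β : Path x' y'} (h : ∀ s t, α s ≠ β t) :
    D.IsTransverse α β := by
  have h0 : D.crossings α β = ∅ := Set.eq_empty_of_forall_notMem fun c hc => h c.1 c.2 hc
  refine ⟨by simp [h0], ?_, ?_, ?_⟩ <;> simp [h0]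

/-- A segment in a cell with one end fixed is transverse to a given path for almost all positions
of the other end. -/
lemma ConvexCell.exists_forall_isTransverse_segment [T2Space M] (C : ConvexCell D)
    (hx : x ∈ C.carrier) {β : Path x' y'} (hβ : D.IsPiecewiseDifferentiable β)
    (hxβ : ∀ t, β t ≠ x) :
    ∃ N : Set ℂ, volume N = 0 ∧ ∀ (y : D.Compl) (hy : y ∈ C.carrier), C.chart y ∉ N →
      D.IsTransverse (C.segment hx hy) β := by
  obtain ⟨E, hE, hβ⟩ := hβ
  let b : ℝ → ℂ := fun r => C.chart (β.extend r : M)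
  have hb : ∀ t : I, b t = C.chart (β t : M) := fun t => by simp [b]
  -- Regular parameters, at which `β` is visible in the chart and has a velocity.
  let T : Set ℝ := {r | ∃ t : I, (t : ℝ) = r ∧ t ∉ E ∧ (β t : M) ∈ C.chart.source}
  have hT : ∀ r ∈ T, HasDerivAt b (deriv b r) r := by
    rintro r ⟨t, rfl, htE, ht⟩
    exact (differentiableAt_of_inChart C.mdifferentiable ht (hβ t htE).2).hasDerivAt
  set P := C.chart (x : M) with hP
  -- Critical values of the cone over `β` with apex `P`: these include the lines through `P` tangent
  -- to `β`.
  let N₁ : Set ℂ := {q | ∃ r ∈ T, ∃ s : ℝ, q = P + s • (b r - P) ∧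
    det (b r - P) (0 + s • deriv b r) = 0}
  -- The regular part of `β` itself, as a ruled surface with zero rulings; avoiding it prevents a
  -- crossing at the end of the segment.
  let N₂ : Set ℂ := {q | ∃ r ∈ T, ∃ s : ℝ, q = b r + s • (0 : ℂ) ∧
    det 0 (deriv b r + s • (0 : ℂ)) = 0}
  -- The line through `P` and `b t`; avoiding it for `t ∈ E` keeps crossings away from exceptional
  -- parameters.
  let N₃ : I → Set ℂ := fun t => {q | ∃ r ∈ (Set.univ : Set ℝ), ∃ s : ℝ, q = P + s • (b t - P) ∧
    det (b t - P) (0 + s • (0 : ℂ)) = 0}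
  have h1 : volume N₁ = 0 := volume_critical_ruled_eq_zero
    (fun r _ => hasDerivAt_const r P) (fun r hr => (hT r hr).sub_const P)
  have h2 : volume N₂ = 0 := volume_critical_ruled_eq_zero hT (fun r _ => hasDerivAt_const r 0)
  have h3 : ∀ t, volume (N₃ t) = 0 := fun t => volume_critical_ruled_eq_zero
    (fun r _ => hasDerivAt_const r P) (fun r _ => hasDerivAt_const r (b t - P))
  refine ⟨N₁ ∪ N₂ ∪ ⋃ t ∈ E, N₃ t, ?_, fun y hy hyN => ?_⟩
  · exact measure_union_null (measure_union_null h1 h2)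
      ((measure_biUnion_null_iff hE.countable).2 fun t _ => h3 t)
  set Q := C.chart (y : M) with hQ
  simp only [Set.mem_union, Set.mem_iUnion, not_or, not_exists] at hyN
  obtain ⟨⟨hQ₁, hQ₂⟩, hQ₃⟩ := hyN
  have key : ∀ c ∈ D.crossings (C.segment hx hy) β, c.1 ∈ Set.Ioo (0 : I) 1 ∧ c.2 ∉ E ∧
      (β c.2 : M) ∈ C.chart.source ∧ b c.2 - P = (c.1 : ℝ) • (Q - P) := by
    rintro ⟨s, t⟩ (hc : C.segment hx hy s = β t)
    have hs : (β t : M) ∈ C.chart.source := hc ▸ (C.segment_mem hx hy s).1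
    have hbt : b t - P = (s : ℝ) • (Q - P) := by
      rw [hb, ← hc, C.chart_segment, AffineMap.lineMap_apply_module']
      simp [hP, hQ]
    have hs0 : s ≠ 0 := by
      rintro rfl
      exact hxβ t (hc.symm.trans (Path.source _))
    have hs0' : (s : ℝ) ≠ 0 := fun h => hs0 (Subtype.ext h)
    have hQb : Q = P + (s : ℝ)⁻¹ • (b t - P) := by
      rw [hbt, smul_smul, inv_mul_cancel₀ hs0', one_smul, add_sub_cancel]
    have htE : t ∉ E := fun htE => hQ₃ t htE ⟨0, trivial, (s : ℝ)⁻¹, hQb, by simp [det]⟩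
    refine ⟨⟨lt_of_le_of_ne s.2.1 (Ne.symm hs0), lt_of_le_of_ne s.2.2 ?_⟩, htE, hs, hbt⟩
    rintro rfl
    refine hQ₂ ⟨t, ⟨t, rfl, htE, hs⟩, 0, ?_, by simp [det]⟩
    have : b t - P = Q - P := by simpa using hbt
    rw [smul_zero, add_zero]
    exact (sub_left_inj.1 this).symm
  refine isTransverse_of_forall (fun c hc => ?_) (fun c hc => ?_) fun c hc => ?_ <;>
    obtain ⟨hs, htE, ht, hbt⟩ := key c hc
  · exact ⟨hs, (hβ _ htE).1⟩
  · exact ⟨differentiableAt_inChart C.mdifferentiable (C.segment_mem hx hy _).1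
      (C.hasDerivAt_segment hx hy hs).differentiableAt, (hβ _ htE).2⟩
  · refine crossingDet_ne_zero C.mdifferentiable hc (C.segment_mem hx hy _).1
      (C.hasDerivAt_segment hx hy hs) (hT _ ⟨c.2, rfl, htE, ht⟩) fun h0 => ?_
    have hs0 : (c.1 : ℝ) ≠ 0 := ne_of_gt (show (0 : ℝ) < c.1 from hs.1)
    refine hQ₁ ⟨c.2, ⟨c.2, rfl, htE, ht⟩, (c.1 : ℝ)⁻¹, ?_, ?_⟩
    · rw [hbt, smul_smul, inv_mul_cancel₀ hs0, one_smul, add_sub_cancel]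
    · rw [hbt, zero_add, det_smul_left, det_smul_right, h0, mul_zero, mul_zero]

end EmbeddedDisk

/-! ### Approximation of paths by transverse broken lines -/

namespace EmbeddedDisk

open Filter Topology unitInterval MeasureTheory

variable {M : Type*} [TopologicalSpace M] [ChartedSpace ℂ M] [OrientedSurface M]
  {D : EmbeddedDisk M} {x y z x' y' z' : D.Compl}

/-- Up to a short path `ℓ` at its end, the part of `α` up to the parameter `t` is homotopic to a
piecewise differentiable path transverse to `β`. -/
def HasTransverseApproximation (α : Path x y) (β : Path x' y') (t : I) : Prop :=
  ∀ W ∈ 𝓝 (α t), ∃ (q : D.Compl) (γ : Path (α 0) q) (ℓ : Path (α t) q),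
    D.IsTransverse γ β ∧ D.IsPiecewiseDifferentiable γ ∧ (∀ s, ℓ s ∈ W) ∧
    Path.Homotopic.Quotient.mk γ =
      (Path.Homotopic.Quotient.mk (α.subpath 0 t)).trans (.mk ℓ)

lemma hasTransverseApproximation_zero (α : Path x y) {β : Path x' y'} (hβ : ∀ t, β t ≠ x) :
    HasTransverseApproximation α β 0 := by
  intro W hW
  refine ⟨α 0, .refl _, .refl _, isTransverse_of_forall_ne fun s t h => hβ t ?_,
    isPiecewiseDifferentiable_refl _, fun _ => mem_of_mem_nhds hW, ?_⟩
  · rw [← h]; simp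
  · rw [Path.subpath_self, ← Path.Homotopic.Quotient.mk_trans, Path.refl_trans_refl]

/-- The approximation at `t` is taken with its error path `ℓ` inside the cell, and is prolonged by a
segment to a generic point near `α t'`. The old and new error paths, the new segment and the piece
of `α` all lie in one cell, where paths with equal ends are homotopic. -/
lemma HasTransverseApproximation.step [T2Space M] {α : Path x y} {β : Path x' y'}
    (hβ : D.IsPiecewiseDifferentiable β) {t t' : I} (htt' : t ≤ t')
    (h : HasTransverseApproximation α β t) (C : ConvexCell D)
    (ht : ∀ s ∈ Set.Icc t t', C.carrier ∈ 𝓝 (α s)) : HasTransverseApproximation α β t' := by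
  intro W hW
  obtain ⟨q, γ, ℓ, h1, h2, h3, h4⟩ := h C.carrier (ht t ⟨le_rfl, htt'⟩)
  have hq : q ∈ C.carrier := by simpa using h3 1
  obtain ⟨N, hN, hNβ⟩ := C.exists_forall_isTransverse_segment hq hβ h1.apply_ne_target
  have hy : α t' ∈ C.carrier := mem_of_mem_nhds (ht t' ⟨htt', le_rfl⟩)
  obtain ⟨q', hq', hq'N, hW'⟩ := C.exists_segment_subset hy hW hN
  refine ⟨q', γ.trans (C.segment hq hq'), C.segment hy hq', h1.trans_left (hNβ q' hq' hq'N),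
    h2.trans (C.isPiecewiseDifferentiable_segment hq hq'), hW', ?_⟩
  have h5 : (Path.Homotopic.Quotient.mk ℓ).trans (.mk (C.segment hq hq')) =
      (Path.Homotopic.Quotient.mk (α.subpath t t')).trans (.mk (C.segment hy hq')) := by
    rw [← Path.Homotopic.Quotient.mk_trans, ← Path.Homotopic.Quotient.mk_trans,
      Path.Homotopic.Quotient.eq]
    refine C.homotopic (fun u => ?_) fun u => ?_
    · rcases exists_half u with ⟨s, rfl⟩ | ⟨s, rfl⟩
      · rw [Path.trans_firstHalf]; exact h3 s
      · rw [Path.trans_secondHalf]; exact C.segment_mem _ _ s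
    · rcases exists_half u with ⟨s, rfl⟩ | ⟨s, rfl⟩
      · rw [Path.trans_firstHalf]
        exact mem_of_mem_nhds (ht _ ⟨Set.Icc.le_convexComb htt' s, Set.Icc.convexComb_le htt' s⟩)
      · rw [Path.trans_secondHalf]; exact C.segment_mem _ _ s
  rw [Path.Homotopic.Quotient.mk_trans, h4, Path.Homotopic.Quotient.trans_assoc, h5,
    ← Path.Homotopic.Quotient.trans_assoc, ← Path.Homotopic.Quotient.mk_trans (α.subpath 0 t)]
  congr 1
  exact Path.Homotopic.Quotient.eq.2 ⟨Path.Homotopy.subpathTransSubpath α 0 t t'⟩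

/-- Every path is homotopic to a piecewise differentiable path which is transverse to a given
piecewise differentiable path. -/
theorem exists_isTransverse_homotopic [T2Space M] (α : Path x y) {β : Path x' y'}
    (hβ : D.IsPiecewiseDifferentiable β) (hx : ∀ t, β t ≠ x) (hy : ∀ t, β t ≠ y) :
    ∃ γ : Path x y, D.IsTransverse γ β ∧ D.IsPiecewiseDifferentiable γ ∧ γ.Homotopic α := by
  choose C hC using D.exists_convexCell
  -- Lebesgue subdivision: each piece of `α` lies in the interior of one cell.
  obtain ⟨t, ht0, htm, ⟨n, hn⟩, ht⟩ := exists_monotone_Icc_subset_open_cover_unitInterval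
    (c := fun x => α ⁻¹' _root_.interior (C x).carrier) (fun x => isOpen_interior.preimage α.continuous)
    fun s _ => Set.mem_iUnion.2 ⟨α s, mem_interior_iff_mem_nhds.2 (hC _)⟩
  have key : ∀ m, HasTransverseApproximation α β (t m) := by
    intro m
    induction m with
    | zero => rw [ht0]; exact hasTransverseApproximation_zero α hx
    | succ m ih =>
      obtain ⟨p, hp⟩ := ht m
      exact ih.step hβ (htm m.le_succ) (C p) fun s hs => mem_interior_iff_mem_nhds.1 (hp hs)
  have h := key n
  rw [hn n le_rfl] at h
  let K := C (α 1)
  obtain ⟨q, γ, ℓ, h1, h2, h3, h4⟩ := h K.carrier (hC _)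
  have hq : q ∈ K.carrier := by simpa using h3 1
  have he : α 1 ∈ K.carrier := mem_of_mem_nhds (hC _)
  obtain ⟨N, hN, hNβ⟩ := K.exists_forall_isTransverse_segment hq hβ h1.apply_ne_target
  obtain ⟨N', hN', hNβ'⟩ := K.exists_forall_isTransverse_segment he hβ
    (fun t => by rw [α.target]; exact hy t)
  -- The path must end exactly at `α 1`, which is not generic. It therefore passes through a vertex
  -- `q'` generic as seen both from `q` and from `α 1`, and returns along a reversed segment.
  obtain ⟨q', hq', hq'N, -⟩ := K.exists_segment_subset he (hC _) (measure_union_null hN hN')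
  rw [Set.mem_union, not_or] at hq'N
  let γ' := (γ.trans (K.segment hq hq')).trans (K.segment he hq').symm
  have h5 : D.IsTransverse γ' β := (h1.trans_left (hNβ q' hq' hq'N.1)).trans_left
    (hNβ' q' hq' hq'N.2).symm_left
  have h6 : D.IsPiecewiseDifferentiable γ' :=
    (h2.trans (K.isPiecewiseDifferentiable_segment hq hq')).trans
      (K.isPiecewiseDifferentiable_segment he hq').symm
  have h7 : (Path.Homotopic.Quotient.mk ℓ).trans (.mk (K.segment hq hq')) =
      .mk (K.segment he hq') := by
    rw [← Path.Homotopic.Quotient.mk_trans, Path.Homotopic.Quotient.eq]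
    refine K.homotopic (fun u => ?_) (K.segment_mem _ _)
    rcases exists_half u with ⟨s, rfl⟩ | ⟨s, rfl⟩
    · rw [Path.trans_firstHalf]; exact h3 s
    · rw [Path.trans_secondHalf]; exact K.segment_mem _ _ s
  have h8 : γ'.Homotopic (α.subpath 0 1) := by
    rw [← Path.Homotopic.Quotient.eq, Path.Homotopic.Quotient.mk_trans,
      Path.Homotopic.Quotient.mk_trans, h4, Path.Homotopic.Quotient.trans_assoc _ (.mk ℓ), h7,
      Path.Homotopic.Quotient.trans_assoc, Path.Homotopic.Quotient.mk_symm,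
      Path.Homotopic.Quotient.trans_symm, Path.Homotopic.Quotient.trans_refl]
  refine ⟨γ'.cast α.source.symm α.target.symm, ?_, ?_, ?_⟩
  · exact ⟨h5.finite, h5.mem_Ioo, h5.differentiableAt, h5.det_ne_zero⟩
  · exact h6
  · rw [Path.subpath_zero_one] at h8
    exact h8.pathCast α.source.symm α.target.symm

end EmbeddedDisk

/-! ### Parts of a concatenation -/

namespace unitInterval

lemma convexComb_firstHalf (s t r : I) :
    Set.Icc.convexComb (firstHalf s) (firstHalf t) r = firstHalf (Set.Icc.convexComb s t r) :=
  Subtype.ext (by simp only [Set.Icc.coe_convexComb, coe_firstHalf]; ring)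

lemma convexComb_secondHalf (s t r : I) :
    Set.Icc.convexComb (secondHalf s) (secondHalf t) r = secondHalf (Set.Icc.convexComb s t r) :=
  Subtype.ext (by simp only [Set.Icc.coe_convexComb, coe_secondHalf]; ring)

lemma firstHalf_zero : firstHalf 0 = 0 := Subtype.ext (by simp [coe_firstHalf])

lemma secondHalf_one : secondHalf 1 = 1 := Subtype.ext (by norm_num [coe_secondHalf])

lemma secondHalf_zero : secondHalf 0 = firstHalf 1 :=
  Subtype.ext (by simp [coe_secondHalf, coe_firstHalf])

end unitInterval

namespace Path

open unitInterval

variable {X : Type*} [TopologicalSpace X] {x y z : X} (γ : Path x y) (γ' : Path y z)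

lemma subpath_apply (s t r : I) : γ.subpath s t r = γ (Set.Icc.convexComb s t r) := rfl

lemma trans_subpath_firstHalf (s t r : I) :
    (γ.trans γ').subpath (firstHalf s) (firstHalf t) r = γ.subpath s t r := by
  rw [subpath_apply, convexComb_firstHalf, trans_firstHalf, subpath_apply]

lemma trans_subpath_secondHalf (s t r : I) :
    (γ.trans γ').subpath (secondHalf s) (secondHalf t) r = γ'.subpath s t r := by
  rw [subpath_apply, convexComb_secondHalf, trans_secondHalf, subpath_apply]

/-- Cutting the subpath at the midpoint gives all of `γ`, then the beginning of `γ'`. -/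
lemma homotopic_trans_subpath_zero_secondHalf (s : I) :
    (((γ.trans γ').subpath 0 (secondHalf s)).cast (γ.trans γ').source.symm
      (trans_secondHalf γ γ' s).symm).Homotopic
      (γ.trans ((γ'.subpath 0 s).cast γ'.source.symm rfl)) := by
  have h : (((γ.trans γ').subpath 0 (secondHalf 0)).trans
      ((γ.trans γ').subpath (secondHalf 0) (secondHalf s))).Homotopic
      ((γ.trans γ').subpath 0 (secondHalf s)) := ⟨Homotopy.subpathTransSubpath _ _ _ _⟩
  have h' := h.symm.pathCast (γ.trans γ').source.symm (trans_secondHalf γ γ' s).symm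
  convert h' using 1
  ext u
  rw [cast_coe]
  rcases exists_half u with ⟨r, rfl⟩ | ⟨r, rfl⟩
  · rw [trans_firstHalf, trans_firstHalf, subpath_apply, secondHalf_zero, ← firstHalf_zero,
      convexComb_firstHalf, trans_firstHalf, Set.Icc.convexComb_zero_one]
  · rw [trans_secondHalf, trans_secondHalf, trans_subpath_secondHalf, cast_coe]

lemma homotopic_trans_subpath_firstHalf_one (s : I) :
    (((γ.trans γ').subpath (firstHalf s) 1).cast (trans_firstHalf γ γ' s).symm
      (γ.trans γ').target.symm).Homotopic
      (((γ.subpath s 1).cast rfl γ.target.symm).trans γ') := by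
  have h : (((γ.trans γ').subpath (firstHalf s) (firstHalf 1)).trans
      ((γ.trans γ').subpath (firstHalf 1) 1)).Homotopic
      ((γ.trans γ').subpath (firstHalf s) 1) := ⟨Homotopy.subpathTransSubpath _ _ _ _⟩
  have h' := h.symm.pathCast (trans_firstHalf γ γ' s).symm (γ.trans γ').target.symm
  convert h' using 1
  ext u
  rw [cast_coe]
  rcases exists_half u with ⟨r, rfl⟩ | ⟨r, rfl⟩
  · rw [trans_firstHalf, trans_firstHalf, trans_subpath_firstHalf, cast_coe]
  · rw [trans_secondHalf, trans_secondHalf, subpath_apply, ← secondHalf_zero, ← secondHalf_one,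
      convexComb_secondHalf, trans_secondHalf, Set.Icc.convexComb_zero_one]

end Path

/-! ### Classes of loops and change of base point -/

section LoopClass

variable {X : Type*} [TopologicalSpace X] {x y z : X}

/-- The product of `FundamentalGroup` reverses concatenation. This determines the side on which
factors appear in the product rules. -/
lemma loopClass_trans (γ γ' : Path x x) : loopClass (γ.trans γ') = loopClass γ' * loopClass γ := rfl

lemma loopClass_eq_iff {γ γ' : Path x x} : loopClass γ = loopClass γ' ↔ γ.Homotopic γ' :=
  Path.Homotopic.Quotient.eq

lemma loopClass_conj_trans (A : Path x y) (γ γ' : Path y y) :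
    loopClass ((A.trans (γ.trans γ')).trans A.symm) =
      loopClass ((A.trans γ').trans A.symm) * loopClass ((A.trans γ).trans A.symm) := by
  rw [← loopClass_trans, loopClass_eq_iff, ← Path.Homotopic.Quotient.eq]
  simp only [Path.Homotopic.Quotient.mk_trans, Path.Homotopic.Quotient.mk_symm,
    Path.Homotopic.Quotient.trans_assoc]
  rw [← Path.Homotopic.Quotient.trans_assoc (.symm (.mk A)),
    Path.Homotopic.Quotient.symm_trans, Path.Homotopic.Quotient.refl_trans]

lemma exists_loopClass_conj_eq (A : Path x y) (g : FundamentalGroup X x) :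
    ∃ γ : Path y y, loopClass ((A.trans γ).trans A.symm) = g := by
  obtain ⟨δ, rfl⟩ := Path.Homotopic.Quotient.mk_surjective g
  refine ⟨(A.symm.trans δ).trans A, Path.Homotopic.Quotient.eq.2 ?_⟩
  rw [← Path.Homotopic.Quotient.eq]
  simp only [Path.Homotopic.Quotient.mk_trans, Path.Homotopic.Quotient.mk_symm,
    Path.Homotopic.Quotient.trans_assoc, Path.Homotopic.Quotient.trans_symm,
    Path.Homotopic.Quotient.trans_refl]
  rw [← Path.Homotopic.Quotient.trans_assoc, Path.Homotopic.Quotient.trans_symm,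
    Path.Homotopic.Quotient.refl_trans]

lemma loopClass_conj_congr (A : Path x y) {γ γ' : Path y y} (h : γ.Homotopic γ') :
    loopClass ((A.trans γ).trans A.symm) = loopClass ((A.trans γ').trans A.symm) :=
  loopClass_eq_iff.2 (((Path.Homotopic.refl A).hcomp h).hcomp (.refl _))

end LoopClass

namespace EmbeddedDisk

open unitInterval

variable {M : Type*} [TopologicalSpace M] [ChartedSpace ℂ M] [OrientedSurface M]
  {D : EmbeddedDisk M}

/-! ### The loops attached to the intersections -/

/-- Describing the two parts by their values allows end points that are equal only propositionally,
and so avoids transporting casts. -/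
lemma crossingClass_eq {α : Path D.before D.before} {β : Path D.after D.after}
    (c : D.crossings α β) {p : D.Compl} (P : Path D.before p) (Q : Path p D.after)
    (hP : ∀ r, P r = α.subpath 0 c.1.1 r) (hQ : ∀ r, Q r = β.subpath c.1.2 1 r) :
    D.crossingClass α β c =
      loopClass (((D.arcToBefore.trans P).trans Q).trans D.arcToAfter.symm) := by
  obtain rfl : p = α c.1.1 := by rw [← P.target, hP]; simp
  have h1 : P = (α.subpath 0 c.1.1).cast α.source.symm rfl := by
    ext r; exact congrArg Subtype.val (hP r)
  have h2 : Q = (β.subpath c.1.2 1).cast c.2 β.target.symm := by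
    ext r; exact congrArg Subtype.val (hQ r)
  rw [h1, h2]
  rfl

lemma crossingClass_trans_firstHalf {α : Path D.before D.before} (α' : Path D.before D.before)
    {β : Path D.after D.after} (c : D.crossings α β)
    (h : (firstHalf c.1.1, c.1.2) ∈ D.crossings (α.trans α') β) :
    D.crossingClass (α.trans α') β ⟨_, h⟩ = D.crossingClass α β c := by
  refine crossingClass_eq _ _ _ (fun r => ?_) fun r => rfl
  refine (Path.trans_subpath_firstHalf α α' 0 c.1.1 r).symm.trans ?_
  simp only [Path.subpath_apply, firstHalf_zero]

/-- The attached loop first runs through all of `α`; inserting the arc to `*` and back splits this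
off as a factor. -/
lemma crossingClass_trans_secondHalf (α : Path D.before D.before) {α' : Path D.before D.before}
    {β : Path D.after D.after} (c : D.crossings α' β)
    (h : (secondHalf c.1.1, c.1.2) ∈ D.crossings (α.trans α') β) :
    D.crossingClass (α.trans α') β ⟨_, h⟩ = D.crossingClass α' β c * D.classBefore α := by
  rw [crossingClass_eq ⟨_, h⟩ (((α.trans α').subpath 0 (secondHalf c.1.1)).cast
    (α.trans α').source.symm (Path.trans_secondHalf α α' c.1.1).symm)
    ((β.subpath c.1.2 1).cast c.2 β.target.symm) (fun r => rfl) (fun r => rfl), crossingClass,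
    classBefore, ← loopClass_trans, loopClass_eq_iff, ← Path.Homotopic.Quotient.eq]
  have h1 := Path.Homotopic.Quotient.eq.2 (Path.homotopic_trans_subpath_zero_secondHalf α α' c.1.1)
  simp only [Path.Homotopic.Quotient.mk_trans, Path.Homotopic.Quotient.mk_symm,
    Path.Homotopic.Quotient.trans_assoc] at h1 ⊢
  rw [h1, ← Path.Homotopic.Quotient.trans_assoc (.symm (.mk D.arcToBefore)),
    Path.Homotopic.Quotient.symm_trans, Path.Homotopic.Quotient.refl_trans,
    Path.Homotopic.Quotient.trans_assoc]

lemma crossingClass_trans_secondHalf_right {α : Path D.before D.before}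
    (β : Path D.after D.after) {β' : Path D.after D.after} (c : D.crossings α β')
    (h : (c.1.1, secondHalf c.1.2) ∈ D.crossings α (β.trans β')) :
    D.crossingClass α (β.trans β') ⟨_, h⟩ = D.crossingClass α β' c := by
  refine crossingClass_eq _ _ _ (fun r => rfl) fun r => ?_
  refine (Path.trans_subpath_secondHalf β β' c.1.2 1 r).symm.trans ?_
  simp only [Path.subpath_apply, secondHalf_one]

/-- After the rest of `β`, the attached loop still runs through all of `β'`. -/
lemma crossingClass_trans_firstHalf_right {α : Path D.before D.before}
    {β : Path D.after D.after} (β' : Path D.after D.after) (c : D.crossings α β)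
    (h : (c.1.1, firstHalf c.1.2) ∈ D.crossings α (β.trans β')) :
    D.crossingClass α (β.trans β') ⟨_, h⟩ = D.classAfter β' * D.crossingClass α β c := by
  have hc : α c.1.1 = β c.1.2 := c.2
  rw [crossingClass_eq ⟨_, h⟩ ((α.subpath 0 c.1.1).cast α.source.symm hc.symm)
    (((β.trans β').subpath (firstHalf c.1.2) 1).cast (Path.trans_firstHalf β β' c.1.2).symm
      (β.trans β').target.symm) (fun r => rfl) (fun r => rfl),
    crossingClass_eq c ((α.subpath 0 c.1.1).cast α.source.symm hc.symm)
      ((β.subpath c.1.2 1).cast rfl β.target.symm) (fun r => rfl) (fun r => rfl),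
    classAfter, ← loopClass_trans, loopClass_eq_iff, ← Path.Homotopic.Quotient.eq]
  have h1 := Path.Homotopic.Quotient.eq.2 (Path.homotopic_trans_subpath_firstHalf_one β β' c.1.2)
  simp only [Path.Homotopic.Quotient.mk_trans, Path.Homotopic.Quotient.mk_symm,
    Path.Homotopic.Quotient.trans_assoc] at h1 ⊢
  rw [h1, ← Path.Homotopic.Quotient.trans_assoc (.symm (.mk D.arcToAfter)),
    Path.Homotopic.Quotient.symm_trans, Path.Homotopic.Quotient.refl_trans,
    Path.Homotopic.Quotient.trans_assoc]

/-! ### The intersections of a concatenation -/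

lemma sign_two_mul (r : ℝ) : SignType.sign (2 * r) = SignType.sign r := by
  rw [sign_mul, sign_pos two_pos, one_mul]

lemma crossingSum_eq_sum {α : Path D.before D.before} {β : Path D.after D.after}
    [Fintype (D.crossings α β)] : D.crossingSum α β = ∑ c : D.crossings α β,
      MonoidAlgebra.single (D.crossingClass α β c)
        (SignType.sign (D.crossingDet α β c.1.1 c.1.2) : ℤ) :=
  finsum_eq_sum_of_fintype _

lemma firstHalf_mem_crossings {α : Path D.before D.before} (α' : Path D.before D.before)
    {β : Path D.after D.after} (c : D.crossings α β) :
    (firstHalf c.1.1, c.1.2) ∈ D.crossings (α.trans α') β :=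
  (Path.trans_firstHalf α α' c.1.1).trans c.2

lemma secondHalf_mem_crossings (α : Path D.before D.before) {α' : Path D.before D.before}
    {β : Path D.after D.after} (c : D.crossings α' β) :
    (secondHalf c.1.1, c.1.2) ∈ D.crossings (α.trans α') β :=
  (Path.trans_secondHalf α α' c.1.1).trans c.2

lemma firstHalf_mem_crossings_right {α : Path D.before D.before} {β : Path D.after D.after}
    (β' : Path D.after D.after) (c : D.crossings α β) :
    (c.1.1, firstHalf c.1.2) ∈ D.crossings α (β.trans β') :=
  Eq.trans c.2 (Path.trans_firstHalf β β' c.1.2).symm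

lemma secondHalf_mem_crossings_right {α : Path D.before D.before} (β : Path D.after D.after)
    {β' : Path D.after D.after} (c : D.crossings α β') :
    (c.1.1, secondHalf c.1.2) ∈ D.crossings α (β.trans β') :=
  Eq.trans c.2 (Path.trans_secondHalf β β' c.1.2).symm

lemma crossingSum_trans_left {α α' : Path D.before D.before} {β : Path D.after D.after}
    (h : D.IsTransverse α β) (h' : D.IsTransverse α' β) :
    D.crossingSum (α.trans α') β = D.crossingSum α β +
      D.crossingSum α' β * MonoidAlgebra.single (D.classBefore α) 1 := by
  -- Each crossing of the concatenation comes from exactly one half, since transversality keeps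
  -- crossings off the corner.
  let F : D.crossings α β ⊕ D.crossings α' β → D.crossings (α.trans α') β := Sum.elim
    (fun c => ⟨_, firstHalf_mem_crossings α' c⟩)
    (fun c => ⟨_, secondHalf_mem_crossings α c⟩)
  have hF : F.Bijective := by
    constructor
    · rintro (c | c) (d | d) hcd <;> have h1 := congrArg Subtype.val hcd <;>
        simp only [F, Sum.elim_inl, Sum.elim_inr, Prod.mk.injEq] at h1
      · exact congrArg _ (Subtype.ext (Prod.ext (firstHalf_injective h1.1) h1.2))
      · exact (firstHalf_ne_secondHalf (h.mem_Ioo _ c.2).1.2.ne h1.1).elim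
      · exact (firstHalf_ne_secondHalf (h.mem_Ioo _ d.2).1.2.ne h1.1.symm).elim
      · exact congrArg _ (Subtype.ext (Prod.ext (secondHalf_injective h1.1) h1.2))
    · rintro ⟨⟨u, t⟩, hc⟩
      rcases exists_half u with ⟨s, rfl⟩ | ⟨s, rfl⟩
      · exact ⟨.inl ⟨(s, t), (Path.trans_firstHalf α α' s).symm.trans hc⟩, rfl⟩
      · exact ⟨.inr ⟨(s, t), (Path.trans_secondHalf α α' s).symm.trans hc⟩, rfl⟩
  have := h.finite.fintype
  have := h'.finite.fintype
  have := Fintype.ofBijective F hF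
  rw [crossingSum_eq_sum, crossingSum_eq_sum, crossingSum_eq_sum, ← hF.sum_comp,
    Fintype.sum_sum_type, Finset.sum_mul]
  congr 1 <;> refine Finset.sum_congr rfl fun c _ => ?_
  · simp only [F, Sum.elim_inl]
    rw [crossingClass_trans_firstHalf, crossingDet_trans_firstHalf _ (h.mem_Ioo _ c.2).1.2
      (h.differentiableAt _ c.2).1, sign_two_mul]
  · simp only [F, Sum.elim_inr]
    rw [crossingClass_trans_secondHalf, crossingDet_trans_secondHalf _ (h'.mem_Ioo _ c.2).1.1
      (h'.differentiableAt _ c.2).1, sign_two_mul, MonoidAlgebra.single_mul_single, mul_one]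

lemma crossingSum_trans_right {α : Path D.before D.before} {β β' : Path D.after D.after}
    (h : D.IsTransverse α β) (h' : D.IsTransverse α β') :
    D.crossingSum α (β.trans β') =
      MonoidAlgebra.single (D.classAfter β') 1 * D.crossingSum α β + D.crossingSum α β' := by
  let F : D.crossings α β ⊕ D.crossings α β' → D.crossings α (β.trans β') := Sum.elim
    (fun c => ⟨_, firstHalf_mem_crossings_right β' c⟩)
    (fun c => ⟨_, secondHalf_mem_crossings_right β c⟩)
  have hF : F.Bijective := by
    constructor
    · rintro (c | c) (d | d) hcd <;> have h1 := congrArg Subtype.val hcd <;>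
        simp only [F, Sum.elim_inl, Sum.elim_inr, Prod.mk.injEq] at h1
      · exact congrArg _ (Subtype.ext (Prod.ext h1.1 (firstHalf_injective h1.2)))
      · exact (firstHalf_ne_secondHalf (h.mem_Ioo _ c.2).2.2.ne h1.2).elim
      · exact (firstHalf_ne_secondHalf (h.mem_Ioo _ d.2).2.2.ne h1.2.symm).elim
      · exact congrArg _ (Subtype.ext (Prod.ext h1.1 (secondHalf_injective h1.2)))
    · rintro ⟨⟨s, u⟩, hc⟩
      rcases exists_half u with ⟨t, rfl⟩ | ⟨t, rfl⟩
      · exact ⟨.inl ⟨(s, t), Eq.trans hc (Path.trans_firstHalf β β' t)⟩, rfl⟩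
      · exact ⟨.inr ⟨(s, t), Eq.trans hc (Path.trans_secondHalf β β' t)⟩, rfl⟩
  have := h.finite.fintype
  have := h'.finite.fintype
  have := Fintype.ofBijective F hF
  rw [crossingSum_eq_sum, crossingSum_eq_sum, crossingSum_eq_sum, ← hF.sum_comp,
    Fintype.sum_sum_type, Finset.mul_sum]
  congr 1 <;> refine Finset.sum_congr rfl fun c _ => ?_
  · simp only [F, Sum.elim_inl]
    rw [crossingClass_trans_firstHalf_right, crossingDet_trans_firstHalf_right _
      (h.mem_Ioo _ c.2).2.2 (h.differentiableAt _ c.2).2, sign_two_mul,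
      MonoidAlgebra.single_mul_single, one_mul]
  · simp only [F, Sum.elim_inr]
    rw [crossingClass_trans_secondHalf_right, crossingDet_trans_secondHalf_right _
      (h'.mem_Ioo _ c.2).2.1 (h'.differentiableAt _ c.2).2, sign_two_mul]

end EmbeddedDisk

namespace EmbeddedDisk

open unitInterval

variable {M : Type*} [TopologicalSpace M] [ChartedSpace ℂ M] [OrientedSurface M]
  {D : EmbeddedDisk M}

/-! ### Homology classes of products -/

lemma homologyClass_single (D : EmbeddedDisk M) (x : D.Pi) (n : ℤ) :
    D.homologyClass (MonoidAlgebra.single x n) =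
      n • FirstHomology.map D.incl D.base (FirstHomology.of x) := by
  simp [homologyClass]

/-- The augmentation of the group ring. -/
def augmentation (D : EmbeddedDisk M) : MonoidAlgebra ℤ D.Pi →+ ℤ :=
  ((MonoidAlgebra.lift ℤ ℤ D.Pi 1 : MonoidAlgebra ℤ D.Pi →ₐ[ℤ] ℤ) : MonoidAlgebra ℤ D.Pi →+ ℤ)

lemma augmentation_single (D : EmbeddedDisk M) (x : D.Pi) (n : ℤ) :
    D.augmentation (MonoidAlgebra.single x n) = n := by
  simp [augmentation]

lemma augmentation_mul_single (u : MonoidAlgebra ℤ D.Pi) (x : D.Pi) :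
    D.augmentation (u * MonoidAlgebra.single x 1) = D.augmentation u := by
  simp [augmentation]

lemma augmentation_single_mul (u : MonoidAlgebra ℤ D.Pi) (x : D.Pi) :
    D.augmentation (MonoidAlgebra.single x 1 * u) = D.augmentation u := by
  simp [augmentation]

/-- The homology class of an element of the fundamental group of the surface with boundary. -/
def homologyOf (D : EmbeddedDisk M) (x : D.Pi) : FirstHomology M (D.incl D.base) :=
  FirstHomology.map D.incl D.base (FirstHomology.of x)

lemma homologyOf_mul (x y : D.Pi) :
    D.homologyOf (x * y) = D.homologyOf x + D.homologyOf y := by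
  rw [homologyOf, homologyOf, homologyOf, ← map_add, FirstHomology.of, map_mul]
  rfl

/-- Each term n·y of `u` becomes n·yx, whose class gains n[x]. -/
lemma homologyClass_mul_single (u : MonoidAlgebra ℤ D.Pi) (x : D.Pi) :
    D.homologyClass (u * MonoidAlgebra.single x 1) =
      D.homologyClass u + D.augmentation u • D.homologyOf x := by
  induction u using MonoidAlgebra.induction_linear with
  | zero => simp
  | add u v hu hv => rw [add_mul, map_add, map_add, map_add, hu, hv, add_smul]; abel
  | single y n =>
    rw [MonoidAlgebra.single_mul_single, homologyClass_single, homologyClass_single,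
      augmentation_single, mul_one, ← smul_add]
    exact congrArg _ (homologyOf_mul y x)

lemma homologyClass_single_mul (u : MonoidAlgebra ℤ D.Pi) (x : D.Pi) :
    D.homologyClass (MonoidAlgebra.single x 1 * u) =
      D.homologyClass u + D.augmentation u • D.homologyOf x := by
  induction u using MonoidAlgebra.induction_linear with
  | zero => simp
  | add u v hu hv => rw [mul_add, map_add, map_add, map_add, hu, hv, add_smul]; abel
  | single y n =>
    rw [MonoidAlgebra.single_mul_single, homologyClass_single, homologyClass_single,
      augmentation_single, one_mul, ← smul_add, add_comm]
    exact congrArg _ (homologyOf_mul x y)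

/-! ### The product rules for the intersection form -/

lemma before_ne_after (D : EmbeddedDisk M) : D.before ≠ D.after := by
  intro h
  have h1 := D.chart.symm.injOn (D.exp_mem_target _) (D.exp_mem_target _) (congrArg Subtype.val h)
  have h2 := congrArg Complex.im h1
  norm_num [Circle.coe_exp, Complex.exp_im] at h2

variable [T2Space M]

lemma exists_classBefore_eq {β : Path D.after D.after} (hβ : D.IsPiecewiseDifferentiable β)
    (h : ∀ t, β t ≠ D.before) (g : D.Pi) :
    ∃ α : Path D.before D.before, D.IsTransverse α β ∧ D.IsPiecewiseDifferentiable α ∧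
      D.classBefore α = g := by
  obtain ⟨α₀, rfl⟩ := exists_loopClass_conj_eq D.arcToBefore g
  obtain ⟨α, h1, h2, h3⟩ := exists_isTransverse_homotopic α₀ hβ h h
  exact ⟨α, h1, h2, loopClass_conj_congr _ h3⟩

lemma exists_classAfter_eq {α : Path D.before D.before} (hα : D.IsPiecewiseDifferentiable α)
    (h : ∀ t, α t ≠ D.after) (g : D.Pi) :
    ∃ β : Path D.after D.after, D.IsTransverse α β ∧ D.IsPiecewiseDifferentiable β ∧
      D.classAfter β = g := by
  obtain ⟨β₀, rfl⟩ := exists_loopClass_conj_eq D.arcToAfter g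
  obtain ⟨β, h1, h2, h3⟩ := exists_isTransverse_homotopic β₀ hα h h
  exact ⟨β, h1.swap, h2, loopClass_conj_congr _ h3⟩

variable {η : MonoidAlgebra ℤ D.Pi →+ MonoidAlgebra ℤ D.Pi →+ MonoidAlgebra ℤ D.Pi}

/-- The form is a Fox derivative in the first variable. -/
lemma IsIntersectionForm.mul_left (hη : D.IsIntersectionForm η) (x y z : D.Pi) :
    η (MonoidAlgebra.single (x * y) 1) (MonoidAlgebra.single z 1) =
      η (MonoidAlgebra.single y 1) (MonoidAlgebra.single z 1) +
      η (MonoidAlgebra.single x 1) (MonoidAlgebra.single z 1) * MonoidAlgebra.single y 1 := by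
  -- The constant loop is auxiliary: transversality to it makes `β` avoid the base point of the
  -- loops chosen next, both transverse to this one `β`.
  obtain ⟨β, h1, h2, rfl⟩ := D.exists_classAfter_eq
    (D.isPiecewiseDifferentiable_refl D.before) (fun _ => D.before_ne_after) z
  obtain ⟨α, h3, -, rfl⟩ := D.exists_classBefore_eq h2 h1.apply_ne_source y
  obtain ⟨α', h4, -, rfl⟩ := D.exists_classBefore_eq h2 h1.apply_ne_source x
  have h5 : D.classBefore α' * D.classBefore α = D.classBefore (α.trans α') :=
    (loopClass_conj_trans D.arcToBefore α α').symm
  rw [h5, hη _ _ (h3.trans_left h4), hη _ _ h3, hη _ _ h4, crossingSum_trans_left h3 h4]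

/-- The form is a Fox derivative in the second variable. -/
lemma IsIntersectionForm.mul_right (hη : D.IsIntersectionForm η) (x y z : D.Pi) :
    η (MonoidAlgebra.single x 1) (MonoidAlgebra.single (y * z) 1) =
      MonoidAlgebra.single y 1 * η (MonoidAlgebra.single x 1) (MonoidAlgebra.single z 1) +
      η (MonoidAlgebra.single x 1) (MonoidAlgebra.single y 1) := by
  obtain ⟨α, h1, h2, rfl⟩ := D.exists_classBefore_eq
    (D.isPiecewiseDifferentiable_refl D.after) (fun _ => D.before_ne_after.symm) x
  obtain ⟨β, h3, -, rfl⟩ := D.exists_classAfter_eq h2 h1.swap.apply_ne_source z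
  obtain ⟨β', h4, -, rfl⟩ := D.exists_classAfter_eq h2 h1.swap.apply_ne_source y
  have h5 : D.classAfter β' * D.classAfter β = D.classAfter (β.trans β') :=
    (loopClass_conj_trans D.arcToAfter β β').symm
  rw [h5, hη _ _ (h3.trans_right h4), hη _ _ h3, hη _ _ h4, crossingSum_trans_right h3 h4]

/-! ### Invariance modulo the third term of the lower central series -/

/-- The Fox rule gives the deviation ε(η(x, z))[y]; it is additive in x because ε forgets the right
factor in that rule. -/
lemma IsIntersectionForm.homologyClass_mul_left (hη : D.IsIntersectionForm η) {k : D.Pi}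
    (hk : k ∈ (⊤ : Subgroup D.Pi).lowerCentralSeries 2) (x z : D.Pi) :
    D.homologyClass (η (MonoidAlgebra.single (k * x) 1) (MonoidAlgebra.single z 1)) =
      D.homologyClass (η (MonoidAlgebra.single x 1) (MonoidAlgebra.single z 1)) := by
  refine apply_mul_eq_of_mem_lowerCentralSeries_two
    (fun x => D.homologyClass (η (MonoidAlgebra.single x 1) (MonoidAlgebra.single z 1)))
    (fun x y => D.augmentation (η (MonoidAlgebra.single x 1) (MonoidAlgebra.single z 1)) •
      D.homologyOf y) (fun x y => ?_) (fun x y w => ?_) (fun x y w => ?_) hk x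
  · rw [hη.mul_left, map_add, homologyClass_mul_single]; abel
  · rw [hη.mul_left, map_add, augmentation_mul_single, ← add_smul, add_comm]
  · rw [homologyOf_mul, smul_add]

lemma IsIntersectionForm.homologyClass_mul_right (hη : D.IsIntersectionForm η) {k : D.Pi}
    (hk : k ∈ (⊤ : Subgroup D.Pi).lowerCentralSeries 2) (x z : D.Pi) :
    D.homologyClass (η (MonoidAlgebra.single x 1) (MonoidAlgebra.single (k * z) 1)) =
      D.homologyClass (η (MonoidAlgebra.single x 1) (MonoidAlgebra.single z 1)) := by
  refine apply_mul_eq_of_mem_lowerCentralSeries_two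
    (fun z => D.homologyClass (η (MonoidAlgebra.single x 1) (MonoidAlgebra.single z 1)))
    (fun y w => D.augmentation (η (MonoidAlgebra.single x 1) (MonoidAlgebra.single w 1)) •
      D.homologyOf y) (fun y w => ?_) (fun y w v => ?_) (fun y w v => ?_) hk z
  · rw [hη.mul_right, map_add, homologyClass_single_mul]; abel
  · rw [homologyOf_mul, smul_add]
  · rw [hη.mul_right, map_add, augmentation_single_mul, ← add_smul, add_comm]

/-- The homology class of the form on elements of `π` only depends on their classes modulo the
third term of the lower central series. -/
lemma homologyClass_homotopyIntersectionForm_congr {x x' z z' : D.Pi}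
    (hx : (QuotientGroup.mk x : D.Pi ⧸ (⊤ : Subgroup D.Pi).lowerCentralSeries 2) =
      QuotientGroup.mk x')
    (hz : (QuotientGroup.mk z : D.Pi ⧸ (⊤ : Subgroup D.Pi).lowerCentralSeries 2) =
      QuotientGroup.mk z') :
    D.homologyClass (D.homotopyIntersectionForm (MonoidAlgebra.single x 1)
      (MonoidAlgebra.single z 1)) =
    D.homologyClass (D.homotopyIntersectionForm (MonoidAlgebra.single x' 1)
      (MonoidAlgebra.single z' 1)) := by
  by_cases h : ∃ η, D.IsIntersectionForm η
  · have hη : D.IsIntersectionForm D.homotopyIntersectionForm := by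
      rw [homotopyIntersectionForm, dif_pos h]
      exact h.choose_spec
    -- Write x = (x / x')·x' with x / x' in Γ₃π.
    have h1 := hη.homologyClass_mul_left (QuotientGroup.eq_iff_div_mem.1 hx) x' z
    have h2 := hη.homologyClass_mul_right (QuotientGroup.eq_iff_div_mem.1 hz) x' z'
    rw [div_mul_cancel] at h1 h2
    rw [h1, h2]
  · simp [homotopyIntersectionForm, dif_neg h]

end EmbeddedDisk

/-! ### Images of multicurves -/

lemma loopClass_map_cast {X : Type*} [TopologicalSpace X] {x : X} (ψ : X ≃ₜ X) (h : ψ x = x)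
    (γ : Path x x) : loopClass ((γ.map ψ.continuous).cast h.symm h.symm) =
      FundamentalGroup.mapOfEq (ψ : C(X, X)) h (loopClass γ) :=
  (FundamentalGroup.mapOfEq_apply (ψ : C(X, X)) h (loopClass γ)).symm

/-- Since ψ also carries the connecting paths along, each based component is moved by the induced
automorphism, with no extra conjugation. -/
lemma Multicurve.toGroupRing_image {X : Type*} [TopologicalSpace X] {x : X} (a : Multicurve X)
    (p : a.Tails x) (ψ : X ≃ₜ X) (h : ψ x = x) :
    (a.image ψ).toGroupRing (p.image ψ h) = ∑ i : Fin a.card,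
      MonoidAlgebra.single (FundamentalGroup.mapOfEq (ψ : C(X, X)) h
        (loopClass (((p i).trans (a.loop i)).trans (p i).symm))) 1 := by
  refine Finset.sum_congr rfl fun i _ => ?_
  rw [← loopClass_map_cast]
  congr 2
  rw [Path.map_trans, Path.map_trans, Path.cast_trans, Path.cast_trans] <;> rfl

end

/-! ### Invariance of the reduced form under the Johnson kernel -/

theorem mainTheorem5 {M : Type*} [TopologicalSpace M] [ChartedSpace ℂ M] [OrientedSurface M]
    [T2Space M] [CompactSpace M] [ConnectedSpace M]
    (H : HeegaardSplitting M) (D : EmbeddedDisk M)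
    (a b : Multicurve D.Compl) (p : a.Tails D.base) (q : b.Tails D.base)
    (ha : D.homologyClass (a.toGroupRing p) ∈
      H.alpha.lagrangian (D.incl D.base) ⊓ H.beta.lagrangian (D.incl D.base))
    (hb : D.homologyClass (b.toGroupRing q) ∈
      H.alpha.lagrangian (D.incl D.base) ⊓ H.beta.lagrangian (D.incl D.base))
    (ψ : D.Compl ≃ₜ D.Compl) (hψ : D.InJohnsonKernel ψ) :
    H.reducedForm D (a.toGroupRing p) (b.toGroupRing q) =
        H.reducedForm D ((a.image ψ).toGroupRing (p.image ψ hψ.fixesBoundary.map_base))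
          (b.toGroupRing q) ∧
      H.reducedForm D (a.toGroupRing p) (b.toGroupRing q) =
        H.reducedForm D (a.toGroupRing p)
          ((b.image ψ).toGroupRing (q.image ψ hψ.fixesBoundary.map_base)) := by
  rw [Multicurve.toGroupRing_image, Multicurve.toGroupRing_image]
  constructor <;>
  -- The equality holds before passing to the quotient, separately for each pair of components.
  · refine congrArg QuotientAddGroup.mk ?_
    simp only [Multicurve.toGroupRing, map_sum, AddMonoidHom.finsetSum_apply]
    refine Finset.sum_congr rfl fun i _ => Finset.sum_congr rfl fun j _ => ?_
    apply EmbeddedDisk.homologyClass_homotopyIntersectionForm_congr <;>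
    first
    | rfl
    | exact (hψ.induced_eq _).symm
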